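/- **Notation.** $(q)_n=\prod_{j=1}^n(1-q^j)$; $\left[{P\atop N}\right]=\frac{(q)_P}{(q)_N(q)_{P-N}}$ if $P\ge N\ge 0$ and $0$ otherwise. *Partition pairs.* A partition in $(N,M)$ is a sequence of integers $M\ge p_N\ge\cdots\ge p_1\ge 0$ and its weight is $\mathrm{wt}(p)=\sum_i p_i$. For non-negative integers $a,b,\alpha,\beta$ with $a+b>0$, $\alpha+\beta>0$, let $R(N,M,a,b,\alpha,\beta)=\sum q^{\mathrm{wt}(\hat q)+\mathrm{wt}(\hat p)}$, summed over all pairs $(\hat q,\hat p)$ of partitions in $(N,M)$ such that $\hat p_i-\hat q_{i+1-a}\ge 1-\alpha$ and $\hat q_i-\hat p_{i+1-b}\ge 1-\beta$ whenever both subscripts lie in $\{1,\dots,N\}$, and such that: if $a=0$ then $\hat q_1\le\alpha-1$ and $\hat p_N\ge M-\alpha+1$; if $b=0$ then $\hat p_1\le\beta-1$ and $\hat q_N\ge M-\beta+1$. *Continued fractions.* For positive coprime integers $s,r$, or $(s,r)=(1,0)$, the continued fraction of $(s:r)$ is the sequence defined recursively by: it is $()$ for $(1:0)$; otherwise its first term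 $c_1$ is the largest integer with $c_1r\le s$, and the remaining terms form the continued fraction of $(r:s-c_1r)$. In addition $(c_1,\dots,c_{k},1)$ is identified with $(c_1,\dots,c_{k}+1)$ for $k\ge1$. **Theorem.** Let $0<p<p'$ be coprime integers and let $(p':p)$ have continued fraction $(c_1,\dots,c_{t-1},c_t+2)$ with $t\ge1$ and all $c_k\ge0$. Let $1\le u\le t$ and $1\le d\le c_u$, let $r,s$ be such that $(c_1,\dots,c_{u-1},d)$ is the continued fraction of $(s:r)$, and let $M\ge0$ be an integer. Then, coefficientwise as formal power series in $q$, $$\lim_{N\to\infty}R(N,M,r,p-r,s,p'-s)=\frac1{(q)_{2M}}\sum\left(q^{\,n_{u,d}+\sum_{k=1}^{u}\sum_{i=1}^{f_k}n_{k,i}^2+\sum_{k=u+1}^{x}\sum_{i=1}^{f_k}n_{k,i}(n_{k,i}-1)}\prod_{k=1}^{x}\ \prod_{i=1+\delta_{1,k}}^{f_k}\left[{2\left(w_k-\sum_{j=1}^i n_{k,j}\right)+n_{k,i-1}+n_{k,i}\atop n_{k,i-1}-n_{k,i}}\right]\right),$$ where $(f_1,\dots,f_{t+1})=(c_1,\dots,c_{u-1},d,c_u-d,c_{u+1},\dots,c_t)$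 and the (finite) sum is over all sequences $n^{(1)},\dots,n^{(x)}$ with $u\le x\le t+1$ such that, for $1\le k\le x$, $n^{(k)}=(n_{k,1},\dots,n_{k,f_k})$ consists of integers with $n_{k,0}\ge n_{k,1}\ge\cdots\ge n_{k,f_k}\ge0$ and $\mathrm{wt}(n^{(k)}):=\sum_{i=1}^{f_k}n_{k,i}\le w_k$; such that $\mathrm{wt}(n^{(x)})=w_x$; and such that, in addition, $\mathrm{wt}(n^{(u)})<w_u$ if $u<x$, $n_{k,f_k}>0$ if $u<k<x$, and $n_{x,f_x}=0$ if $x<t+1$. Here $$w_1=M;\quad w_k=n_{k-1,f_{k-1}}\ (2\le k\le u);\quad w_{u+1}=w_u-1-\mathrm{wt}(n^{(u)});\quad w_k=n_{k-1,f_{k-1}}-1\ (u+2\le k\le x);$$ $$n_{1,0}=\infty;\quad n_{k,0}=w_{k-1}-\mathrm{wt}(n^{(k-1)})\ (2\le k\le u);\quad n_{u+1,0}=n_{u,f_u}+1;\quad n_{k,0}=w_{k-1}+1-\mathrm{wt}(n^{(k-1)})\ (u+2\le k\le x).$$ -/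

import Mathlib

open Filter Topology
open scoped PowerSeries PowerSeries.WithPiTopology

namespace BurgeTree

/-! ### q-shifted factorials and Gaussian polynomials, as elements of `ℤ⟦X⟧` with `q = X` -/

/-- `(q)_n = (1 - q)(1 - q^2) ⋯ (1 - q^n)`. -/
noncomputable def qFact (n : ℕ) : ℤ⟦X⟧ :=
  ∏ j ∈ Finset.Icc 1 n, (1 - PowerSeries.X ^ j)

/-- `1 / (q)_n`; the constant coefficient of `(q)_n` is `1`, so this is a genuine inverse. -/
noncomputable def qFactInv (n : ℕ) : ℤ⟦X⟧ :=
  PowerSeries.invOfUnit (qFact n) 1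

/-- The Gaussian polynomial `(q)_P / ((q)_N (q)_{P-N})` if `P ≥ N`, and `0` otherwise. -/
noncomputable def gauss (P N : ℕ) : ℤ⟦X⟧ :=
  if N ≤ P then qFact P * qFactInv N * qFactInv (P - N) else 0

/-! ### Restricted partition pairs -/

/-- A partition in `(N, M)`: `N` parts with `M ≥ p_N ≥ ⋯ ≥ p_1 ≥ 0`;
the part `p_i` is the value at the index `i - 1`. -/
abbrev BoxSeq (N M : ℕ) : Type := Fin N → Fin (M + 1)

/-- The part `p_i` for `1 ≤ i ≤ N`. The values `p_0 = 0` and `p_i = M` for `i > N` are conventions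
that are only ever read when the partition has no parts at all. -/
def entry {N M : ℕ} (p : BoxSeq N M) (i : ℕ) : ℤ :=
  if i = 0 then 0 else if h : i - 1 < N then ((p ⟨i - 1, h⟩ : ℕ) : ℤ) else (M : ℤ)

/-- The weight of a partition in `(N, M)`: the sum of its parts. -/
def boxWt {N M : ℕ} (p : BoxSeq N M) : ℕ := ∑ i, (p i : ℕ)

/-- `(q, p)` is a restricted partition pair in `(N₁, M₁) × (N₂, M₂)`,
for the parameters `a, b, α, β`. -/
structure IsRestricted (N₁ M₁ N₂ M₂ a b α β : ℕ) (q : BoxSeq N₁ M₁) (p : BoxSeq N₂ M₂) :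
    Prop where
  monotone_q : Monotone q
  monotone_p : Monotone p
  /-- `p_i - q_{i+1-a} ≥ 1 - α`, whenever both subscripts are meaningful (here `j = i + 1 - a`) -/
  first : ∀ i j : ℕ, 1 ≤ i → i ≤ N₂ → 1 ≤ j → j ≤ N₁ → j + a = i + 1 →
    entry p i - entry q j ≥ 1 - (α : ℤ)
  /-- `q_i - p_{i+1-b} ≥ 1 - β`, whenever both subscripts are meaningful (here `j = i + 1 - b`) -/
  second : ∀ i j : ℕ, 1 ≤ i → i ≤ N₁ → 1 ≤ j → j ≤ N₂ → j + b = i + 1 →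
    entry q i - entry p j ≥ 1 - (β : ℤ)
  special_a : a = 0 → entry q 1 ≤ (α : ℤ) - 1
  special_b : b = 0 → entry p 1 ≤ (β : ℤ) - 1
  special_a' : (a : ℤ) = (N₂ : ℤ) - N₁ → entry p N₂ ≥ (M₁ : ℤ) - α + 1
  special_b' : (b : ℤ) = (N₁ : ℤ) - N₂ → entry q N₁ ≥ (M₂ : ℤ) - β + 1

open Classical in
/-- The generating function of the restricted partition pairs. -/
noncomputable def genFun (N₁ M₁ N₂ M₂ a b α β : ℕ) : ℤ⟦X⟧ :=
  ∑ π : BoxSeq N₁ M₁ × BoxSeq N₂ M₂ with IsRestricted N₁ M₁ N₂ M₂ a b α β π.1 π.2,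
    PowerSeries.X ^ (boxWt π.1 + boxWt π.2)

/-- `R(N, M, a, b, α, β) = R(N, M, N, M, a, b, α, β)`. -/
noncomputable def R (N M a b α β : ℕ) : ℤ⟦X⟧ := genFun N M N M a b α β

/-! ### Continued fractions of pairs -/

/-- The continued fraction of `(s : r)`: it is empty for `r = 0`; otherwise its first term is the
largest `c` with `c r ≤ s`, followed by the continued fraction of `(r : s - c r)`. -/
def contFrac : ℕ → ℕ → List ℕ
  | _, 0 => []
  | s, r + 1 => s / (r + 1) :: contFrac (r + 1) (s % (r + 1))
termination_by _ r => r
decreasing_by exact Nat.mod_lt _ (Nat.succ_pos _)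

/-- `l` is the continued fraction of `(s : r)`, where `s, r` are positive coprime integers or
`(s, r) = (1, 0)`, and where `(c_1, …, c_k, 1)` is equated with `(c_1, …, c_k + 1)` for `k ≥ 1`. -/
def IsContFrac (l : List ℕ) (s r : ℕ) : Prop :=
  0 < s ∧ Nat.Coprime s r ∧
    (contFrac s r = l ∨
      ∃ (l' : List ℕ) (a : ℕ), l = l' ++ [a, 1] ∧ contFrac s r = l' ++ [a + 1])

/-! ### The fermionic sum -/

/-- `(f_1, …, f_{t+1}) = (c_1, …, c_{u-1}, d, c_u - d, c_{u+1}, …, c_t)`. -/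
def fSeq (c : ℕ → ℕ) (u d k : ℕ) : ℕ :=
  if k < u then c k else if k = u then d else if k = u + 1 then c u - d else c (k - 1)

/-- The partition `n^{(k)}`, `1 ≤ k ≤ x`, of the sequence `ν = (n^{(1)}, …, n^{(x)})`. -/
def prt (ν : List (List ℕ)) (k : ℕ) : List ℕ := ν.getD (k - 1) []

/-- The part `n_{k,i}` with `1 ≤ k ≤ x` and `1 ≤ i ≤ f_k`. -/
def part (ν : List (List ℕ)) (k i : ℕ) : ℕ := (prt ν k).getD (i - 1) 0

/-- The pair `(n_{k,0}, w_k)` for `k ≥ 1`, with `n_{1,0} = N` (possibly `∞`) and `w_1 = M`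
(the value at `k = 0` is never used). For an admissible sequence no subtraction below truncates. -/
def bounds (N : ℕ∞) (M : ℕ) (f : ℕ → ℕ) (u : ℕ) (ν : List (List ℕ)) : ℕ → ℕ∞ × ℕ∞
  | 0 => (N, M)
  | 1 => (N, M)
  | k + 2 =>
    -- `last` is `n_{k+1, f_{k+1}}`, `w` is `w_{k+1}`, `wt` is the weight of `n^{(k+1)}`
    let prev := bounds N M f u ν (k + 1)
    let last : ℕ∞ := if f (k + 1) = 0 then prev.1 else (part ν (k + 1) (f (k + 1)) : ℕ∞)
    let w : ℕ∞ := prev.2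
    let wt : ℕ∞ := ((prt ν (k + 1)).sum : ℕ∞)
    if k + 2 ≤ u then (w - wt, last)
    else if k + 2 = u + 1 then (last + 1, w - 1 - wt)
    else (w + 1 - wt, last - 1)

/-- `w_k`. -/
def w (N : ℕ∞) (M : ℕ) (f : ℕ → ℕ) (u : ℕ) (ν : List (List ℕ)) (k : ℕ) : ℕ∞ :=
  (bounds N M f u ν k).2

/-- `n_{k,i}` for `0 ≤ i ≤ f_k`, including `n_{k,0}`. -/
def n (N : ℕ∞) (M : ℕ) (f : ℕ → ℕ) (u : ℕ) (ν : List (List ℕ)) (k i : ℕ) : ℕ∞ :=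
  if i = 0 then (bounds N M f u ν k).1 else (part ν k i : ℕ∞)

/-- The sequences `ν = (n^{(1)}, …, n^{(x)})` of partitions over which the fermionic sum runs;
`x` is the length of `ν`. -/
structure IsAdmissible (N : ℕ∞) (M t : ℕ) (f : ℕ → ℕ) (u : ℕ) (ν : List (List ℕ)) : Prop where
  le_length : u ≤ ν.length
  length_le : ν.length ≤ t + 1
  /-- `n^{(k)}` has `f_k` parts and `n_{k,0} ≥ n_{k,1} ≥ ⋯ ≥ n_{k,f_k} ≥ 0` -/
  length_prt : ∀ k, 1 ≤ k → k ≤ ν.length → (prt ν k).length = f k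
  antitone : ∀ k i, 1 ≤ k → k ≤ ν.length → 1 ≤ i → i ≤ f k →
    n N M f u ν k i ≤ n N M f u ν k (i - 1)
  wt_le : ∀ k, 1 ≤ k → k ≤ ν.length → ((prt ν k).sum : ℕ∞) ≤ w N M f u ν k
  wt_last : ((prt ν ν.length).sum : ℕ∞) = w N M f u ν ν.length
  wt_u : u < ν.length → ((prt ν u).sum : ℕ∞) < w N M f u ν u
  pos : ∀ k, u < k → k < ν.length → 0 < n N M f u ν k (f k)
  zero : ν.length < t + 1 → n N M f u ν ν.length (f ν.length) = 0

/-- The exponent `n_{u,d} + ∑_{k=1}^u ∑_i n_{k,i}^2 + ∑_{k=u+1}^x ∑_i n_{k,i} (n_{k,i} - 1)`. -/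
def qExponent (f : ℕ → ℕ) (u d : ℕ) (ν : List (List ℕ)) : ℕ :=
  part ν u d
    + ∑ k ∈ Finset.Icc 1 u, ∑ i ∈ Finset.Icc 1 (f k), part ν k i ^ 2
    + ∑ k ∈ Finset.Icc (u + 1) ν.length, ∑ i ∈ Finset.Icc 1 (f k), part ν k i * (part ν k i - 1)

/-- The Gaussian `[2 (w_k - ∑_{j=1}^i n_{k,j}) + n_{k,i-1} + n_{k,i}, n_{k,i-1} - n_{k,i}]`.
It is only used where `w_k` and `n_{k,i-1}` are finite. -/
noncomputable def gaussFactor (N : ℕ∞) (M : ℕ) (f : ℕ → ℕ) (u : ℕ) (ν : List (List ℕ))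
    (k i : ℕ) : ℤ⟦X⟧ :=
  gauss
    (2 * ((w N M f u ν k).toNat - ∑ j ∈ Finset.Icc 1 i, part ν k j)
      + (n N M f u ν k (i - 1)).toNat + part ν k i)
    ((n N M f u ν k (i - 1)).toNat - part ν k i)

/-- The summand for `ν`, with the Gaussian for `k = i = 1` removed. -/
noncomputable def term (N : ℕ∞) (M : ℕ) (f : ℕ → ℕ) (u d : ℕ) (ν : List (List ℕ)) : ℤ⟦X⟧ :=
  PowerSeries.X ^ qExponent f u d ν *
    ∏ k ∈ Finset.Icc 1 ν.length, ∏ i ∈ Finset.Icc (if k = 1 then 2 else 1) (f k),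
      gaussFactor N M f u ν k i

end BurgeTree

/-!
Give the two partitions of a pair independent boxes. Splitting off the largest part of either
partition gives recurrences which determine the generating function, and an alternating sum of
products of two Gaussian polynomials satisfies the same recurrences. In this form the `q`-Saalschütz
summation yields Burge's recurrence, which expresses `R(N, M, a, b, α + a, β + b)` as
`∑ n, q^(n^2) [2M + N - n, N - n] R(n, M - n, a, b, α, β)`. Together with the symmetry that
transposes both partitions, and so exchanges `(N, a, b)` with `(M, α, β)`, it runs Euclid's
algorithm on `(s : r)` and `(p' - s : p - r)` simultaneously. When the two expansions part, after
`d` steps of stage `u`, a second recurrence with exponents `n(n - 1)` takes over. Each step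
contributes one part `n_{k,i}`, its power of `q` and its Gaussian. The Gaussian for `k = i = 1` is
the only one that depends on `N`, and it tends to `1 / (q)_{2M}` as `N → ∞`.
-/

namespace BurgeTree

/-! ### Gaussian polynomials -/

section CommSemiring

variable {A : Type*} [CommSemiring A] (q : A)

/-- The Gaussian polynomial `[n + m, n]` at `q`, which is the generating function of the partitions
in `(n, m)`. It is defined by the `q`-Pascal recurrence, so that `q` may be any element of any
commutative semiring. -/
def boxGen : ℕ → ℕ → A
  | 0, _ => 1
  | _ + 1, 0 => 1
  | n + 1, m + 1 => boxGen (n + 1) m + q ^ (m + 1) * boxGen n (m + 1)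

@[simp] theorem boxGen_zero_left (m : ℕ) : boxGen q 0 m = 1 := by
  simp [boxGen]

@[simp] theorem boxGen_zero_right (n : ℕ) : boxGen q n 0 = 1 := by
  cases n <;> simp [boxGen]

theorem boxGen_succ_succ (n m : ℕ) : boxGen q (n + 1) (m + 1) =
    boxGen q (n + 1) m + q ^ (m + 1) * boxGen q n (m + 1) := by
  rw [boxGen]

theorem boxGen_succ_succ' : ∀ n m : ℕ, boxGen q (n + 1) (m + 1) =
    boxGen q n (m + 1) + q ^ (n + 1) * boxGen q (n + 1) m
  | 0, 0 => by simp [boxGen_succ_succ]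
  | 0, m + 1 => by
    calc boxGen q 1 (m + 2)
      _ = (boxGen q 0 (m + 1) + q * boxGen q 1 m) + q ^ (m + 2) := by
        rw [boxGen_succ_succ, boxGen_succ_succ' 0 m, boxGen_zero_left, boxGen_zero_left, mul_one,
          zero_add, pow_one]
      _ = boxGen q 0 (m + 2) + q ^ (0 + 1) * boxGen q 1 (m + 1) := by
        rw [boxGen_succ_succ q 0 m, boxGen_zero_left, boxGen_zero_left]
        ring
  | n + 1, 0 => by
    calc boxGen q (n + 2) 1
      _ = 1 + q * (boxGen q n 1 + q ^ (n + 1)) := by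
        rw [boxGen_succ_succ, boxGen_succ_succ' n 0, boxGen_zero_right, boxGen_zero_right, mul_one,
          zero_add, pow_one]
      _ = boxGen q (n + 1) 1 + q ^ (n + 2) * boxGen q (n + 2) 0 := by
        rw [boxGen_succ_succ q n 0, boxGen_zero_right, boxGen_zero_right]
        ring
  | n + 1, m + 1 => by
    calc boxGen q (n + 1 + 1) (m + 1 + 1)
      _ = boxGen q (n + 2) (m + 1) + q ^ (m + 2) * boxGen q (n + 1) (m + 2) :=
        boxGen_succ_succ q (n + 1) (m + 1)
      _ = (boxGen q (n + 1) (m + 1) + q ^ (n + 2) * boxGen q (n + 2) m) +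
          q ^ (m + 2) * (boxGen q n (m + 2) + q ^ (n + 1) * boxGen q (n + 1) (m + 1)) := by
        rw [boxGen_succ_succ' (n + 1) m, boxGen_succ_succ' n (m + 1)]
      _ = (boxGen q (n + 1) (m + 1) + q ^ (m + 2) * boxGen q n (m + 2)) +
          q ^ (n + 2) * (boxGen q (n + 2) m + q ^ (m + 1) * boxGen q (n + 1) (m + 1)) := by
        ring
      _ = boxGen q (n + 1) (m + 2) + q ^ (n + 2) * boxGen q (n + 2) (m + 1) := by
        rw [boxGen_succ_succ q n (m + 1), boxGen_succ_succ q (n + 1) m]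

theorem boxGen_comm : ∀ n m : ℕ, boxGen q n m = boxGen q m n
  | 0, _ => by simp
  | _ + 1, 0 => by simp
  | n + 1, m + 1 => by
    rw [boxGen_succ_succ, boxGen_succ_succ' q m n, boxGen_comm (n + 1) m, boxGen_comm n (m + 1)]

-- Both sides are `q`-trinomial coefficients, and as such satisfy the same three-term recurrence.
theorem boxGen_mul_boxGen : ∀ n m l : ℕ,
    boxGen q n (m + l) * boxGen q m l = boxGen q (n + m) l * boxGen q n m
  | 0, m, l => by simp
  | n + 1, 0, l => by simp
  | n + 1, m + 1, 0 => by simp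
  | n + 1, m + 1, l + 1 => by
    have left_recurrence : boxGen q (n + 1) (m + 1 + (l + 1)) * boxGen q (m + 1) (l + 1) =
        boxGen q (n + 1) (m + 1 + l) * boxGen q (m + 1) l +
        q ^ (l + 1) * (boxGen q (n + 1) (m + (l + 1)) * boxGen q m (l + 1)) +
        q ^ (m + l + 2) * (boxGen q n (m + 1 + (l + 1)) * boxGen q (m + 1) (l + 1)) := by
      rw [← add_assoc (m + 1), boxGen_succ_succ q n, add_mul]
      nth_rw 1 [boxGen_succ_succ q m l]
      rw [show m + (l + 1) = m + 1 + l by ring]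
      ring
    have right_recurrence : boxGen q (n + 1 + (m + 1)) (l + 1) * boxGen q (n + 1) (m + 1) =
        boxGen q (n + 1 + (m + 1)) l * boxGen q (n + 1) (m + 1) +
        q ^ (l + 1) * (boxGen q (n + 1 + m) (l + 1) * boxGen q (n + 1) m) +
        q ^ (m + l + 2) * (boxGen q (n + (m + 1)) (l + 1) * boxGen q n (m + 1)) := by
      rw [← add_assoc (n + 1), boxGen_succ_succ q (n + 1 + m), add_mul, mul_assoc (q ^ (l + 1))]
      nth_rw 2 [boxGen_succ_succ q n m]
      rw [show n + (m + 1) = n + 1 + m by ring]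
      ring
    rw [left_recurrence, right_recurrence, boxGen_mul_boxGen (n + 1) (m + 1) l,
      boxGen_mul_boxGen (n + 1) m (l + 1), boxGen_mul_boxGen n (m + 1) (l + 1)]

theorem map_boxGen {B : Type*} [CommSemiring B] (φ : A →+* B) :
    ∀ n m : ℕ, φ (boxGen q n m) = boxGen (φ q) n m
  | 0, _ => by simp
  | _ + 1, 0 => by simp
  | n + 1, m + 1 => by
    rw [boxGen_succ_succ, boxGen_succ_succ, map_add, map_mul, map_pow, map_boxGen φ (n + 1) m,
      map_boxGen φ n (m + 1)]

/-- The Gaussian polynomial `[n + m, n]` for integers `n` and `m`, with the convention that it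
vanishes when `n` or `m` is negative. -/
def intBox (n m : ℤ) : A := if 0 ≤ n ∧ 0 ≤ m then boxGen q n.toNat m.toNat else 0

@[simp] theorem intBox_natCast (n m : ℕ) : intBox q n m = boxGen q n m := by
  simp [intBox]

theorem intBox_of_neg_left {n : ℤ} (hn : n < 0) (m : ℤ) : intBox q n m = 0 :=
  if_neg (by omega)

theorem intBox_of_neg_right (n : ℤ) {m : ℤ} (hm : m < 0) : intBox q n m = 0 :=
  if_neg (by omega)

theorem intBox_comm (n m : ℤ) : intBox q n m = intBox q m n := by
  unfold intBox
  simp only [boxGen_comm q n.toNat, and_comm (a := 0 ≤ n)]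

theorem intBox_zero_left {m : ℤ} (hm : 0 ≤ m) : intBox q 0 m = 1 := by
  simp [intBox, hm]

theorem intBox_zero_right {n : ℤ} (hn : 0 ≤ n) : intBox q n 0 = 1 := by
  rw [intBox_comm, intBox_zero_left q hn]

theorem intBox_mul_intBox (n l : ℤ) {m : ℤ} (hm : 0 ≤ m) :
    intBox q n (m + l) * intBox q m l = intBox q (n + m) l * intBox q n m := by
  rcases lt_or_ge n 0 with hn | hn
  · simp [intBox_of_neg_left q hn]
  rcases lt_or_ge l 0 with hl | hl
  · simp [intBox_of_neg_right q _ hl]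
  lift n to ℕ using hn
  lift m to ℕ using hm
  lift l to ℕ using hl
  exact_mod_cast boxGen_mul_boxGen q n m l

end CommSemiring

section CommRing

variable {A : Type*} [CommRing A] (q : A)

theorem boxGen_succ_mul (k m : ℕ) :
    boxGen q k (m + 1) * (1 - q ^ (m + 1)) = boxGen q k m * (1 - q ^ (k + m + 1)) := by
  cases k with
  | zero => simp
  | succ k =>
    linear_combination boxGen_succ_succ q k m - q ^ (m + 1) * boxGen_succ_succ' q k m

theorem boxGen_mul_prod_one_sub_pow (k m : ℕ) :
    boxGen q k m * ∏ j ∈ Finset.Icc 1 m, (1 - q ^ j) =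
      ∏ j ∈ Finset.Icc 1 m, (1 - q ^ (k + j)) := by
  induction m with
  | zero => simp
  | succ m ih =>
    rw [Finset.prod_Icc_succ_top (by omega), Finset.prod_Icc_succ_top (by omega), ← ih]
    linear_combination (∏ j ∈ Finset.Icc 1 m, (1 - q ^ j)) * boxGen_succ_mul q k m

end CommRing

section Semifield

variable {F : Type*} [Semifield F] {q : F}

theorem intBox_eq_last (n m : ℤ) (h : n ≠ 0 ∨ m ≠ 0) :
    intBox q n m = intBox q n (m - 1) + q ^ m * intBox q (n - 1) m := by
  rcases lt_trichotomy n 0 with hn | rfl | hn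
  · simp [intBox_of_neg_left q hn, intBox_of_neg_left q (show n - 1 < 0 by omega)]
  · rw [intBox_of_neg_left q (show (0 : ℤ) - 1 < 0 by omega), mul_zero, add_zero]
    rcases lt_or_ge m 0 with hm | hm
    · rw [intBox_of_neg_right q _ hm, intBox_of_neg_right q _ (by omega)]
    · rw [intBox_zero_left q hm, intBox_zero_left q (by omega)]
  rcases lt_trichotomy m 0 with hm | rfl | hm
  · simp [intBox_of_neg_right q _ hm, intBox_of_neg_right q _ (show m - 1 < 0 by omega)]
  · rw [intBox_of_neg_right q _ (show (0 : ℤ) - 1 < 0 by omega), intBox_zero_right q hn.le,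
      intBox_zero_right q (by omega), zpow_zero, zero_add, mul_one]
  obtain ⟨n, rfl⟩ : ∃ k : ℕ, n = (k + 1 : ℕ) := ⟨(n - 1).toNat, by omega⟩
  obtain ⟨m, rfl⟩ : ∃ k : ℕ, m = (k + 1 : ℕ) := ⟨(m - 1).toNat, by omega⟩
  rw [show ((n + 1 : ℕ) : ℤ) - 1 = n by omega, show ((m + 1 : ℕ) : ℤ) - 1 = m by omega]
  simp only [intBox_natCast, zpow_natCast]
  exact boxGen_succ_succ q n m

theorem intBox_eq_first (n m : ℤ) (h : n ≠ 0 ∨ m ≠ 0) :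
    intBox q n m = intBox q (n - 1) m + q ^ n * intBox q n (m - 1) := by
  rw [intBox_comm, intBox_eq_last m n h.symm, intBox_comm q m, intBox_comm q (m - 1)]

/-! ### The `q`-Vandermonde and `q`-Pfaff–Saalschütz summations -/

-- The lattice paths counted by the left-hand side are cut where they meet an antidiagonal.
theorem intBox_eq_sum (hq : q ≠ 0) (X : ℕ) (n m : ℤ) (h : X ≤ n + m) :
    intBox q n m = ∑ j ∈ Finset.range (X + 1),
      q ^ (((X : ℤ) - j) * (n - j)) * intBox q j (X - j) * intBox q (n - j) (m - X + j) := by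
  obtain ⟨Y, hY⟩ : ∃ Y : ℕ, n + m = X + Y := ⟨(n + m - X).toNat, by omega⟩
  induction Y generalizing n m with
  | zero =>
    obtain rfl : m = X - n := by omega
    have off_diagonal : ∀ j : ℕ, n ≠ j → intBox q (n - j) (X - n - X + j) = 0 := fun j hj => by
      rcases lt_or_gt_of_ne hj with h | h
      · exact intBox_of_neg_left q (by omega) _
      · exact intBox_of_neg_right q _ (by omega)
    by_cases hn : 0 ≤ n ∧ n ≤ X
    · lift n to ℕ using hn.1
      rw [Finset.sum_eq_single_of_mem n (by rw [Finset.mem_range]; omega)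
        fun j _ hj => by rw [off_diagonal j (by omega), mul_zero]]
      simp [intBox_zero_left]
    · rw [intBox, if_neg (by omega), Finset.sum_eq_zero fun j hj => by
        rw [off_diagonal j (by rw [Finset.mem_range] at hj; omega), mul_zero]]
  | succ Y ih =>
    rw [intBox_eq_last n m (by omega), ih n (m - 1) (by omega) (by omega),
      ih (n - 1) m (by omega) (by omega), Finset.mul_sum, ← Finset.sum_add_distrib]
    refine Finset.sum_congr rfl fun j _ => ?_
    have hpow : q ^ m * q ^ (((X : ℤ) - j) * (n - 1 - j)) =
        q ^ (((X : ℤ) - j) * (n - j)) * q ^ (m - X + j) := by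
      rw [← zpow_add₀ hq, ← zpow_add₀ hq]
      ring_nf
    rw [intBox_eq_last (n - j) (m - X + j) (by omega), mul_add, ← mul_assoc, ← mul_assoc,
      ← mul_assoc, hpow, show m - 1 - (X : ℤ) + j = m - X + j - 1 by ring,
      show n - 1 - (j : ℤ) = n - j - 1 by ring]
    ring

theorem intBox_eq_sum_Ico (hq : q ≠ 0) {m A : ℕ} (hm : m ≤ A) {L S : ℤ} (h : A ≤ L + S) :
    intBox q (L - m) S = ∑ k ∈ Finset.Ico m (A + 1), q ^ (((A : ℤ) - k) * (L - k)) *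
      intBox q (k - m) (A - k) * intBox q (L - k) (S - A + k) := by
  obtain ⟨D, rfl⟩ := Nat.exists_eq_add_of_le hm
  rw [Finset.sum_Ico_eq_sum_range, show m + D + 1 - m = D + 1 by omega,
    intBox_eq_sum hq D _ _ (by push_cast at h; omega)]
  refine Finset.sum_congr rfl fun j _ => ?_
  push_cast
  ring_nf

theorem intBox_add_eq_sum (hq : q ≠ 0) (k : ℕ) {C D : ℤ} (h : 0 ≤ C + D) :
    intBox q (k + C) D = ∑ m ∈ Finset.range (k + 1),
      q ^ ((m : ℤ) * (m + C)) * intBox q m (k - m) * intBox q (m + C) (D - m) := by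
  rw [intBox_eq_sum hq k _ _ (by omega), ← Finset.sum_range_reflect]
  refine Finset.sum_congr rfl fun j hj => ?_
  rw [show k + 1 - 1 - j = k - j by omega,
    Nat.cast_sub (Nat.le_of_lt_succ (Finset.mem_range.1 hj)), intBox_comm q (k - j : ℤ)]
  ring_nf

theorem intBox_sub_mul_intBox (A : ℤ) {m k : ℕ} (hmk : m ≤ k) :
    intBox q (k - m) (A - k) * intBox q m (A - m) = intBox q k (A - k) * intBox q m (k - m) := by
  have := intBox_mul_intBox q m (A - k) (m := k - m) (by omega)
  rwa [show (k : ℤ) - m + (A - k) = A - m by ring, add_sub_cancel, mul_comm] at this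

theorem saalschutz (hq : q ≠ 0) (A C : ℕ) (B L : ℤ) :
    ∑ m ∈ Finset.range (A + 1), q ^ ((m : ℤ) * (m + C)) *
      intBox q (L - m) (A + B) * intBox q m (A - m) * intBox q (m + C) (B - m - C) =
    intBox q L (A + C) * intBox q (L + C) (B - C) := by
  rcases lt_or_ge L 0 with hL | hL
  · rw [intBox_of_neg_left q hL, zero_mul]
    exact Finset.sum_eq_zero fun m _ => by simp [intBox_of_neg_left q (show L - m < 0 by omega)]
  rcases lt_or_ge B C with hB | hB
  · rw [intBox_of_neg_right q (L + C) (by omega), mul_zero]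
    exact Finset.sum_eq_zero fun m _ => by
      rw [intBox_of_neg_right q (m + C : ℤ) (by omega), mul_zero]
  calc
    _ = ∑ m ∈ Finset.range (A + 1), ∑ k ∈ Finset.Ico m (A + 1), q ^ ((m : ℤ) * (m + C)) *
          (q ^ (((A : ℤ) - k) * (L - k)) * intBox q (k - m) (A - k) * intBox q (L - k) (B + k)) *
          intBox q m (A - m) * intBox q (m + C) (B - m - C) := by
      refine Finset.sum_congr rfl fun m hm => ?_
      rw [intBox_eq_sum_Ico hq (Nat.le_of_lt_succ (Finset.mem_range.1 hm)) (by omega),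
        Finset.mul_sum, Finset.sum_mul, Finset.sum_mul, add_sub_cancel_left]
    _ = ∑ k ∈ Finset.range (A + 1), ∑ m ∈ Finset.range (k + 1), q ^ ((m : ℤ) * (m + C)) *
          (q ^ (((A : ℤ) - k) * (L - k)) * intBox q (k - m) (A - k) * intBox q (L - k) (B + k)) *
          intBox q m (A - m) * intBox q (m + C) (B - m - C) := by
      simp only [Finset.range_eq_Ico]
      rw [Finset.sum_Ico_Ico_comm]
    _ = ∑ k ∈ Finset.range (A + 1), q ^ (((A : ℤ) - k) * (L - k)) * intBox q k (A - k) *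
          (intBox q (L - k) (B + k) * intBox q (k + C) (B - C)) := by
      refine Finset.sum_congr rfl fun k _ => ?_
      rw [intBox_add_eq_sum hq k (by omega), Finset.mul_sum, Finset.mul_sum]
      refine Finset.sum_congr rfl fun m hm => ?_
      have := intBox_sub_mul_intBox (q := q) A (Nat.le_of_lt_succ (Finset.mem_range.1 hm))
      rw [show B - m - C = B - C - m by ring]
      calc
        _ = q ^ ((m : ℤ) * (m + C)) * q ^ (((A : ℤ) - k) * (L - k)) * intBox q (L - k) (B + k) *
              intBox q (m + C) (B - C - m) * (intBox q (k - m) (A - k) * intBox q m (A - m)) := by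
          ring
        _ = _ := by rw [this]; ring
    _ = ∑ k ∈ Finset.range (A + 1), q ^ (((A : ℤ) - k) * (L - k)) * intBox q k (A - k) *
          intBox q (L - k) (A + C - A + k) * intBox q (L + C) (B - C) := by
      refine Finset.sum_congr rfl fun k _ => ?_
      have := intBox_mul_intBox q (L - k) (B - C) (m := k + C) (by omega)
      rw [show (k : ℤ) + C + (B - C) = B + k by ring, show L - k + (k + C) = L + C by ring] at this
      rw [this, show (A : ℤ) + C - A + k = k + C by ring]
      ring
    _ = _ := by rw [intBox_eq_sum hq A L (A + C) (by omega), Finset.sum_mul]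

end Semifield

/-! ### Alternating sums over the affine Weyl group of type `A₁` -/

section Bosonic

variable {F : Type*} [Field F]

/-- The contribution of the `l`-th translation to `bosonicSum`. -/
noncomputable def transTerm (q : F) (K κ a α N₁ M₁ N₂ M₂ l : ℤ) : F :=
  q ^ (l * κ * (N₁ - N₂ + a) - l * K * α + l ^ 2 * K * κ) *
    intBox q (N₁ + l * K) (M₁ - l * κ) * intBox q (N₂ - l * K) (M₂ + l * κ)

/-- The contribution of the `l`-th reflection to `bosonicSum`. -/
noncomputable def reflTerm (q : F) (K κ a α N₁ M₁ N₂ M₂ l : ℤ) : F :=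
  q ^ ((α - l * κ) * (N₁ - N₂ + a - l * K)) *
    intBox q (N₁ + a - l * K) (M₁ - α + l * κ) * intBox q (N₂ - a + l * K) (M₂ + α - l * κ)

/-- The bosonic form of the generating function of the pairs of lattice paths that end at
`(N₁, M₁)` and `(N₂, M₂)`, start at relative position `(a, -α)` and avoid each other's translates
by the multiples of `(K, -κ)`. Only finitely many terms are nonzero when `K` is positive. -/
noncomputable def bosonicSum (q : F) (K κ a α N₁ M₁ N₂ M₂ : ℤ) : F :=
  ∑ᶠ l : ℤ, (transTerm q K κ a α N₁ M₁ N₂ M₂ l - reflTerm q K κ a α N₁ M₁ N₂ M₂ l)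

variable {q : F} {K κ a α N₁ M₁ N₂ M₂ : ℤ}

theorem transTerm_eq_zero {l : ℤ}
    (h : N₁ + l * K < 0 ∨ M₁ - l * κ < 0 ∨ N₂ - l * K < 0 ∨ M₂ + l * κ < 0) :
    transTerm q K κ a α N₁ M₁ N₂ M₂ l = 0 := by
  unfold transTerm
  rcases h with h | h | h | h <;>
    simp only [intBox_of_neg_left q h, intBox_of_neg_right q _ h, mul_zero, zero_mul]

theorem reflTerm_eq_zero {l : ℤ}
    (h : N₁ + a - l * K < 0 ∨ M₁ - α + l * κ < 0 ∨ N₂ - a + l * K < 0 ∨ M₂ + α - l * κ < 0) :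
    reflTerm q K κ a α N₁ M₁ N₂ M₂ l = 0 := by
  unfold reflTerm
  rcases h with h | h | h | h <;>
    simp only [intBox_of_neg_left q h, intBox_of_neg_right q _ h, mul_zero, zero_mul]

theorem hasFiniteSupport_transTerm (hK : 0 < K) :
    (transTerm q K κ a α N₁ M₁ N₂ M₂).HasFiniteSupport := by
  refine (Set.finite_Icc (-|N₁|) |N₂|).subset fun l hl => ?_
  contrapose! hl
  refine Function.notMem_support.2 (transTerm_eq_zero ?_)
  rw [Set.mem_Icc, not_and_or, not_le, not_le] at hl
  rcases hl with hl | hl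
  · left
    nlinarith [le_abs_self N₁, abs_nonneg N₁]
  · right; right; left
    nlinarith [le_abs_self N₂, abs_nonneg N₂]

theorem hasFiniteSupport_reflTerm (hK : 0 < K) :
    (reflTerm q K κ a α N₁ M₁ N₂ M₂).HasFiniteSupport := by
  refine (Set.finite_Icc (-|N₂ - a|) |N₁ + a|).subset fun l hl => ?_
  contrapose! hl
  refine Function.notMem_support.2 (reflTerm_eq_zero ?_)
  rw [Set.mem_Icc, not_and_or, not_le, not_le] at hl
  rcases hl with hl | hl
  · right; right; left
    nlinarith [le_abs_self (N₂ - a), abs_nonneg (N₂ - a)]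
  · left
    nlinarith [le_abs_self (N₁ + a), abs_nonneg (N₁ + a)]

theorem hasFiniteSupport_transTerm_sub_reflTerm (hK : 0 < K) : (fun l =>
    transTerm q K κ a α N₁ M₁ N₂ M₂ l - reflTerm q K κ a α N₁ M₁ N₂ M₂ l).HasFiniteSupport :=
  (hasFiniteSupport_transTerm hK).sub (hasFiniteSupport_reflTerm hK)

theorem bosonicSum_eq_sub (hK : 0 < K) : bosonicSum q K κ a α N₁ M₁ N₂ M₂ =
    ∑ᶠ l, transTerm q K κ a α N₁ M₁ N₂ M₂ l - ∑ᶠ l, reflTerm q K κ a α N₁ M₁ N₂ M₂ l :=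
  finsum_sub_distrib (hasFiniteSupport_transTerm hK) (hasFiniteSupport_reflTerm hK)

theorem bosonicSum_eq_zero (h : ∀ l, transTerm q K κ a α N₁ M₁ N₂ M₂ l = 0)
    (h' : ∀ l, reflTerm q K κ a α N₁ M₁ N₂ M₂ l = 0) : bosonicSum q K κ a α N₁ M₁ N₂ M₂ = 0 := by
  simp only [bosonicSum, h, h', sub_zero, finsum_zero]

theorem bosonicSum_eq_add_mul {a' α' N₁' M₁' N₂' M₂' a'' α'' N₁'' M₁'' N₂'' M₂'' : ℤ}
    (hK : 0 < K) (c : F)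
    (htrans : ∀ l, transTerm q K κ a α N₁ M₁ N₂ M₂ l =
      transTerm q K κ a' α' N₁' M₁' N₂' M₂' l + c * transTerm q K κ a'' α'' N₁'' M₁'' N₂'' M₂'' l)
    (hrefl : ∀ l, reflTerm q K κ a α N₁ M₁ N₂ M₂ l =
      reflTerm q K κ a' α' N₁' M₁' N₂' M₂' l + c * reflTerm q K κ a'' α'' N₁'' M₁'' N₂'' M₂'' l) :
    bosonicSum q K κ a α N₁ M₁ N₂ M₂ = bosonicSum q K κ a' α' N₁' M₁' N₂' M₂' +
      c * bosonicSum q K κ a'' α'' N₁'' M₁'' N₂'' M₂'' := by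
  rw [bosonicSum, bosonicSum, bosonicSum, mul_finsum, ← finsum_add_distrib
    (hasFiniteSupport_transTerm_sub_reflTerm hK)
    ((hasFiniteSupport_transTerm_sub_reflTerm hK).fun_mul_right fun _ => c)]
  refine finsum_congr fun l => ?_
  rw [htrans, hrefl]
  ring

theorem bosonicSum_swap (hK : 0 < K) : bosonicSum q K κ a α N₁ M₁ N₂ M₂ =
    bosonicSum q K κ (K - a) (κ - α) N₂ M₂ N₁ M₁ := by
  rw [bosonicSum_eq_sub hK, bosonicSum_eq_sub hK]
  congr 1
  · refine finsum_eq_of_bijective _ (Equiv.neg ℤ).bijective fun l => ?_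
    simp only [transTerm, Equiv.neg_apply]
    ring_nf
  · refine finsum_eq_of_bijective _ (Equiv.subLeft 1).bijective fun l => ?_
    simp only [reflTerm, Equiv.subLeft_apply]
    ring_nf

theorem bosonicSum_transpose {N M : ℤ} (hK : 0 < K) (hκ : 0 < κ) :
    bosonicSum q K κ a α N M N M = bosonicSum q κ K α a M N M N := by
  rw [bosonicSum_eq_sub hK, bosonicSum_eq_sub hκ]
  congr 1
  · refine finsum_eq_of_bijective _ (Equiv.neg ℤ).bijective fun l => ?_
    simp only [transTerm, Equiv.neg_apply, intBox_comm q (M + _), intBox_comm q (M - _)]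
    ring_nf
  · refine finsum_congr fun l => ?_
    simp only [reflTerm, intBox_comm q (M + α - l * κ), intBox_comm q (M - α + l * κ)]
    ring_nf

theorem transTerm_eq_last (hq : q ≠ 0) {l : ℤ} (h : N₁ + l * K ≠ 0 ∨ M₁ - l * κ ≠ 0) :
    transTerm q K κ a α N₁ M₁ N₂ M₂ l = transTerm q K κ a α N₁ (M₁ - 1) N₂ M₂ l +
      q ^ M₁ * transTerm q K κ a α (N₁ - 1) M₁ N₂ M₂ l := by
  have hpow : q ^ (l * κ * (N₁ - N₂ + a) - l * K * α + l ^ 2 * K * κ) * q ^ (M₁ - l * κ) =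
      q ^ M₁ * q ^ (l * κ * (N₁ - 1 - N₂ + a) - l * K * α + l ^ 2 * K * κ) := by
    rw [← zpow_add₀ hq, ← zpow_add₀ hq]
    ring_nf
  unfold transTerm
  rw [intBox_eq_last _ _ h, show N₁ + l * K - 1 = N₁ - 1 + l * K by ring,
    show M₁ - l * κ - 1 = M₁ - 1 - l * κ by ring]
  linear_combination
    intBox q (N₁ - 1 + l * K) (M₁ - l * κ) * intBox q (N₂ - l * K) (M₂ + l * κ) * hpow

theorem reflTerm_eq_last (hq : q ≠ 0) {l : ℤ} (h : N₁ + a - l * K ≠ 0 ∨ M₁ - α + l * κ ≠ 0) :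
    reflTerm q K κ a α N₁ M₁ N₂ M₂ l = reflTerm q K κ a α N₁ (M₁ - 1) N₂ M₂ l +
      q ^ M₁ * reflTerm q K κ a α (N₁ - 1) M₁ N₂ M₂ l := by
  have hpow : q ^ ((α - l * κ) * (N₁ - N₂ + a - l * K)) * q ^ (M₁ - α + l * κ) =
      q ^ M₁ * q ^ ((α - l * κ) * (N₁ - 1 - N₂ + a - l * K)) := by
    rw [← zpow_add₀ hq, ← zpow_add₀ hq]
    ring_nf
  unfold reflTerm
  rw [intBox_eq_last _ _ h, show N₁ + a - l * K - 1 = N₁ - 1 + a - l * K by ring,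
    show M₁ - α + l * κ - 1 = M₁ - 1 - α + l * κ by ring]
  linear_combination
    intBox q (N₁ - 1 + a - l * K) (M₁ - α + l * κ) *
      intBox q (N₂ - a + l * K) (M₂ + α - l * κ) * hpow

theorem bosonicSum_eq_last (hq : q ≠ 0) (hK : 0 < K) (hκ : 0 < κ) (hN₁ : 0 ≤ N₁) (hM₁ : 0 ≤ M₁)
    (hN₂ : 0 ≤ N₂) (hM₂ : 0 ≤ M₂) (hpos : N₁ ≠ 0 ∨ M₁ ≠ 0) (hN : N₂ < N₁ + a)
    (hM : M₂ < M₁ + (κ - α)) :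
    bosonicSum q K κ a α N₁ M₁ N₂ M₂ = bosonicSum q K κ a α N₁ (M₁ - 1) N₂ M₂ +
      q ^ M₁ * bosonicSum q K κ a α (N₁ - 1) M₁ N₂ M₂ := by
  refine bosonicSum_eq_add_mul hK _ (fun l => transTerm_eq_last hq ?_)
    fun l => reflTerm_eq_last hq ?_ <;>
  rcases (by omega : l ≤ -1 ∨ l = 0 ∨ 1 ≤ l) with hl | rfl | hl
  · right
    nlinarith
  · simpa using hpos
  · left
    nlinarith
  · left
    nlinarith
  · left
    omega
  · right
    nlinarith

theorem bosonicSum_eq_zero_of_end (hN : N₂ = N₁ + a) (hM : M₁ = M₂ + α) :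
    bosonicSum q K κ a α N₁ M₁ N₂ M₂ = 0 := by
  subst hN hM
  refine (finsum_congr fun l => ?_).trans finsum_zero
  unfold transTerm reflTerm
  rw [show l * κ * (N₁ - (N₁ + a) + a) - l * K * α + l ^ 2 * K * κ =
    (α - l * κ) * (N₁ - (N₁ + a) + a - l * K) by ring,
    show M₂ + α - α + l * κ = M₂ + l * κ by ring, show N₁ + a - a + l * K = N₁ + l * K by ring]
  ring

theorem bosonicSum_eq_zero_of_start (hK : 0 < K) : bosonicSum q K κ 0 0 N₁ M₁ N₂ M₂ = 0 := by
  rw [bosonicSum_eq_sub hK, sub_eq_zero]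
  refine finsum_eq_of_bijective _ (Equiv.neg ℤ).bijective fun l => ?_
  simp only [transTerm, reflTerm, Equiv.neg_apply]
  ring_nf

theorem bosonicSum_zero_zero (hK : 0 < K) (hκ : 0 < κ) (hN₂ : N₂ < a) (hM₂ : M₂ < κ - α) :
    bosonicSum q K κ a α 0 0 N₂ M₂ = intBox q N₂ M₂ := by
  have htrans : ∀ l ≠ 0, transTerm q K κ a α 0 0 N₂ M₂ l = 0 := fun l hl => by
    refine transTerm_eq_zero ?_
    rcases lt_or_gt_of_ne hl with hl | hl
    · left
      nlinarith
    · right; left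
      nlinarith
  have hrefl : ∀ l, reflTerm q K κ a α 0 0 N₂ M₂ l = 0 := fun l => by
    refine reflTerm_eq_zero ?_
    rcases lt_or_ge 0 l with hl | hl
    · right; right; right
      nlinarith
    · right; right; left
      nlinarith
  simp only [bosonicSum, hrefl, sub_zero]
  rw [finsum_eq_single _ 0 htrans]
  simp [transTerm, intBox_zero_left]

theorem bosonicSum_neg_one_left (hK : 0 < K) (haK : a ≤ K) (hN₂ : N₂ < a) :
    bosonicSum q K κ a α (-1) M₁ N₂ M₂ = 0 := by
  refine bosonicSum_eq_zero (fun l => transTerm_eq_zero ?_) (fun l => reflTerm_eq_zero ?_) <;>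
  rcases lt_or_ge 0 l with hl | hl
  · right; right; left
    nlinarith
  · left
    nlinarith
  · left
    nlinarith
  · right; right; left
    nlinarith

theorem bosonicSum_neg_one_right (hκ : 0 < κ) (hα : 0 ≤ α) (hM₂ : M₂ < κ - α) :
    bosonicSum q K κ a α N₁ (-1) N₂ M₂ = 0 := by
  refine bosonicSum_eq_zero (fun l => transTerm_eq_zero ?_) (fun l => reflTerm_eq_zero ?_)
  · rcases lt_or_ge l 0 with hl | hl
    · right; right; right
      nlinarith
    · right; left
      nlinarith
  · rcases lt_or_ge 0 l with hl | hl
    · right; right; right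
      nlinarith
    · right; left
      nlinarith

variable {N M : ℤ}

theorem transTerm_eq_first (hq : q ≠ 0) {l : ℤ} (h : N - l * K ≠ 0 ∨ M + l * κ ≠ 0) :
    transTerm q K κ 1 0 N M N M l = transTerm q K κ 0 0 N M (N - 1) M l +
      q ^ N * transTerm q K κ 1 1 N M N (M - 1) l := by
  have hpow : q ^ (l * κ * (N - N + 1) - l * K * 0 + l ^ 2 * K * κ) * q ^ (N - l * K) =
      q ^ N * q ^ (l * κ * (N - N + 1) - l * K * 1 + l ^ 2 * K * κ) := by
    rw [← zpow_add₀ hq, ← zpow_add₀ hq]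
    ring_nf
  unfold transTerm
  rw [intBox_eq_first _ _ h, show N - l * K - 1 = N - 1 - l * K by ring,
    show M + l * κ - 1 = M - 1 + l * κ by ring, show N - (N - 1) + 0 = N - N + 1 by ring]
  linear_combination
    intBox q (N + l * K) (M - l * κ) * intBox q (N - l * K) (M - 1 + l * κ) * hpow

theorem reflTerm_eq_first (hq : q ≠ 0) {l : ℤ} (h : N + 1 - l * K ≠ 0 ∨ M - 0 + l * κ ≠ 0) :
    reflTerm q K κ 1 0 N M N M l = reflTerm q K κ 0 0 N M (N - 1) M l +
      q ^ N * reflTerm q K κ 1 1 N M N (M - 1) l := by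
  have hpow : q ^ ((0 - l * κ) * (N - N + 1 - l * K)) * q ^ (N + 1 - l * K) =
      q ^ N * q ^ ((1 - l * κ) * (N - N + 1 - l * K)) := by
    rw [← zpow_add₀ hq, ← zpow_add₀ hq]
    ring_nf
  unfold reflTerm
  rw [intBox_eq_first _ _ h, show N + 1 - l * K - 1 = N + 0 - l * K by ring,
    show M - 0 + l * κ - 1 = M - 1 + l * κ by ring, show N - (N - 1) + 0 = N - N + 1 by ring,
    show N - 1 - 0 + l * K = N - 1 + l * K by ring, show M - 1 + 1 - l * κ = M + 0 - l * κ by ring]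
  linear_combination
    intBox q (N + 1 - l * K) (M - 1 + l * κ) * intBox q (N - 1 + l * K) (M + 0 - l * κ) * hpow

theorem bosonicSum_eq_first (hq : q ≠ 0) (hK : 0 < K) (hκ : 0 < κ) (hN : 0 ≤ N) (hM : 1 ≤ M) :
    bosonicSum q K κ 1 0 N M N M = bosonicSum q K κ 0 0 N M (N - 1) M +
      q ^ N * bosonicSum q K κ 1 1 N M N (M - 1) := by
  refine bosonicSum_eq_add_mul hK _ (fun l => transTerm_eq_first hq ?_)
    fun l => reflTerm_eq_first hq ?_ <;>
  rcases lt_or_ge l 0 with hl | hl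
  · left
    nlinarith
  · right
    nlinarith
  · left
    nlinarith
  · right
    nlinarith

-- The first path must begin with a horizontal step and the second one with a vertical step.
theorem bosonicSum_one_zero (hq : q ≠ 0) (hK : 0 < K) (hκ : 0 < κ) (hN : 0 ≤ N) (hM : 0 ≤ M) :
    bosonicSum q K κ 1 0 N (M + 1) N (M + 1) = q ^ N * bosonicSum q K κ 1 1 N M N M := by
  rw [bosonicSum_eq_first hq hK hκ hN (by omega), bosonicSum_eq_zero_of_start hK,
    add_sub_cancel_right, bosonicSum_eq_last hq hK hκ hN (by omega) hN hM (by omega) (by omega)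
      (by omega), bosonicSum_eq_zero_of_end (N₁ := N - 1) (by ring) rfl]
  simp

end Bosonic

section Burge

variable {F : Type*} [Field F] {q : F}

theorem finsum_int_eq_sum_range {A : Type*} [AddCommMonoid A] {k : ℕ} {f : ℤ → A}
    (hf : ∀ n : ℤ, n < 0 ∨ k < n → f n = 0) : ∑ᶠ n, f n = ∑ n ∈ Finset.range (k + 1), f n := by
  rw [finsum_eq_finsetSum_of_support_subset f (s := (Finset.range (k + 1)).map Nat.castEmbedding),
    Finset.sum_map]
  · rfl
  · intro n hn
    have : 0 ≤ n ∧ n ≤ k := by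
      contrapose! hn
      exact Function.notMem_support.2 (hf n (by omega))
    exact Finset.mem_coe.2 (Finset.mem_map.2
      ⟨n.toNat, Finset.mem_range.2 (by omega), Int.toNat_of_nonneg this.1⟩)

theorem saalschutz_symm_of_nonneg (hq : q ≠ 0) {x y : ℤ} (hx : 0 ≤ x) (hy : 0 ≤ y) (N M : ℕ) :
    ∑ n ∈ Finset.range (M + 1), q ^ ((n : ℤ) ^ 2) * intBox q (N - n) (2 * M) *
      (intBox q (n - x) (M - n + y) * intBox q (n + x) (M - n - y)) =
    q ^ (x ^ 2) * (intBox q (N - x) (M + (x + y)) * intBox q (N + x) (M - (x + y))) := by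
  have out_of_range : ∀ n : ℤ, n < x ∨ M - y < n →
      intBox q (n - x) (M - n + y) * intBox q (n + x) (M - n - y) = 0 := by
    rintro n (h | h)
    · rw [intBox_of_neg_left q (by omega), zero_mul]
    · rw [intBox_of_neg_right q (n + x) (by omega), mul_zero]
  rcases lt_or_ge (M : ℤ) (x + y) with hM | hM
  · rw [intBox_of_neg_right q (N + x) (by omega), mul_zero, mul_zero]
    exact Finset.sum_eq_zero fun n _ => by rw [out_of_range n (by omega), mul_zero]
  obtain ⟨A, hA⟩ : ∃ A : ℕ, (A : ℤ) = M - x + y := ⟨(M - x + y).toNat, by omega⟩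
  obtain ⟨C, hC⟩ : ∃ C : ℕ, (C : ℤ) = 2 * x := ⟨(2 * x).toNat, by omega⟩
  calc
    _ = ∑ᶠ n : ℤ, q ^ (n ^ 2) * intBox q (N - n) (2 * M) *
          (intBox q (n - x) (M - n + y) * intBox q (n + x) (M - n - y)) :=
      (finsum_int_eq_sum_range fun n hn => by rw [out_of_range n (by omega), mul_zero]).symm
    _ = ∑ᶠ m : ℤ, q ^ (x ^ 2) * (q ^ (m * (m + C)) * intBox q (N - x - m) (A + (M + x - y)) *
          intBox q m (A - m) * intBox q (m + C) (M + x - y - m - C)) := by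
      rw [← finsum_comp_equiv (Equiv.addRight x)]
      refine finsum_congr fun m => ?_
      rw [Equiv.coe_addRight, hA, hC, show (m + x) ^ 2 = x ^ 2 + m * (m + 2 * x) by ring,
        zpow_add₀ hq]
      ring_nf
    _ = q ^ (x ^ 2) * ∑ m ∈ Finset.range (A + 1), q ^ ((m : ℤ) * (m + C)) *
          intBox q (N - x - m) (A + (M + x - y)) * intBox q m (A - m) *
          intBox q (m + C) (M + x - y - m - C) := by
      rw [← mul_finsum, finsum_int_eq_sum_range]
      rintro m (hm | hm)
      · rw [intBox_of_neg_left q hm (A - m), mul_zero, zero_mul]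
      · rw [intBox_of_neg_right q m (by omega), mul_zero, zero_mul]
    _ = _ := by
      rw [saalschutz hq, hA, hC]
      ring_nf

theorem saalschutz_symm (hq : q ≠ 0) {x y : ℤ} (hxy : 0 ≤ x ∧ 0 ≤ y ∨ x ≤ 0 ∧ y ≤ 0) (N M : ℕ) :
    ∑ n ∈ Finset.range (M + 1), q ^ ((n : ℤ) ^ 2) * intBox q (N - n) (2 * M) *
      (intBox q (n - x) (M - n + y) * intBox q (n + x) (M - n - y)) =
    q ^ (x ^ 2) * (intBox q (N - x) (M + (x + y)) * intBox q (N + x) (M - (x + y))) := by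
  rcases hxy with ⟨hx, hy⟩ | ⟨hx, hy⟩
  · exact saalschutz_symm_of_nonneg hq hx hy N M
  · have := saalschutz_symm_of_nonneg hq (neg_nonneg.2 hx) (neg_nonneg.2 hy) N M
    simp only [sub_neg_eq_add, ← sub_eq_add_neg, neg_sq, neg_sub_left, add_comm y] at this
    simpa only [mul_comm (intBox q (_ + x) _)] using this

variable {K κ a α : ℤ}

theorem transTerm_burge (hq : q ≠ 0) (hK : 0 ≤ K) (hκ : 0 ≤ κ) (N M : ℕ) (l : ℤ) :
    transTerm q K (κ + K) a (α + a) N M N M l = ∑ n ∈ Finset.range (M + 1),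
      q ^ ((n : ℤ) ^ 2) * intBox q (N - n) (2 * M) *
        transTerm q K κ a α n (M - n) n (M - n) l := by
  have h := saalschutz_symm hq (x := l * K) (y := l * κ) (by
    rcases le_total 0 l with hl | hl
    · exact Or.inl ⟨mul_nonneg hl hK, mul_nonneg hl hκ⟩
    · exact Or.inr ⟨mul_nonpos_of_nonpos_of_nonneg hl hK,
        mul_nonpos_of_nonpos_of_nonneg hl hκ⟩) N M
  rw [transTerm, show l * (κ + K) * (N - N + a) - l * K * (α + a) + l ^ 2 * K * (κ + K) =
    (l * κ * a - l * K * α + l ^ 2 * K * κ) + (l * K) ^ 2 by ring, zpow_add₀ hq,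
    show (M : ℤ) - l * (κ + K) = M - (l * K + l * κ) by ring,
    show (M : ℤ) + l * (κ + K) = M + (l * K + l * κ) by ring, mul_assoc, mul_assoc,
    mul_comm (intBox q (N + l * K : ℤ) _), ← h, Finset.mul_sum]
  refine Finset.sum_congr rfl fun n _ => ?_
  rw [transTerm, show l * κ * ((n : ℤ) - n + a) = l * κ * a by ring]
  ring

theorem reflTerm_burge (hq : q ≠ 0) (ha : 0 ≤ a) (haK : a ≤ K) (hα : 0 ≤ α) (hακ : α ≤ κ)
    (N M : ℕ) (l : ℤ) :
    reflTerm q K (κ + K) a (α + a) N M N M l = ∑ n ∈ Finset.range (M + 1),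
      q ^ ((n : ℤ) ^ 2) * intBox q (N - n) (2 * M) *
        reflTerm q K κ a α n (M - n) n (M - n) l := by
  have h := saalschutz_symm hq (x := a - l * K) (y := α - l * κ) (by
    rcases (by omega : l ≤ 0 ∨ 1 ≤ l) with hl | hl
    · left; constructor <;> nlinarith
    · right; constructor <;> nlinarith) N M
  rw [reflTerm, show (α + a - l * (κ + K)) * ((N : ℤ) - N + a - l * K) =
      (α - l * κ) * (a - l * K) + (a - l * K) ^ 2 by ring, zpow_add₀ hq,
    show (M : ℤ) - (α + a) + l * (κ + K) = M - (a - l * K + (α - l * κ)) by ring,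
    show (M : ℤ) + (α + a) - l * (κ + K) = M + (a - l * K + (α - l * κ)) by ring,
    show (N : ℤ) + a - l * K = N + (a - l * K) by ring,
    show (N : ℤ) - a + l * K = N - (a - l * K) by ring, mul_assoc, mul_assoc,
    mul_comm (intBox q (N + (a - l * K) : ℤ) _), ← h, Finset.mul_sum]
  refine Finset.sum_congr rfl fun n _ => ?_
  rw [reflTerm, show (α - l * κ) * ((n : ℤ) - n + a - l * K) = (α - l * κ) * (a - l * K) by ring,
    show (n : ℤ) + a - l * K = n + (a - l * K) by ring,
    show (n : ℤ) - a + l * K = n - (a - l * K) by ring,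
    show (M : ℤ) - n - α + l * κ = M - n - (α - l * κ) by ring,
    show (M : ℤ) - n + α - l * κ = M - n + (α - l * κ) by ring]
  ring

theorem bosonicSum_burge (hq : q ≠ 0) (hK : 0 < K) (ha : 0 ≤ a) (haK : a ≤ K) (hα : 0 ≤ α)
    (hακ : α ≤ κ) (N M : ℕ) :
    bosonicSum q K (κ + K) a (α + a) N M N M = ∑ n ∈ Finset.range (M + 1),
      q ^ ((n : ℤ) ^ 2) * intBox q (N - n) (2 * M) * bosonicSum q K κ a α n (M - n) n (M - n) := by
  simp only [bosonicSum, mul_finsum]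
  rw [← finsum_sum_comm _ _ fun n _ =>
    (hasFiniteSupport_transTerm_sub_reflTerm hK).fun_mul_right fun _ => _]
  refine finsum_congr fun l => ?_
  rw [transTerm_burge hq hK.le (hα.trans hακ), reflTerm_burge hq ha haK hα hακ,
    ← Finset.sum_sub_distrib]
  simp only [mul_sub]

end Burge

/-! ### Restricted partition pairs as pairs of lattice paths -/

/-- A partition in `(N, M)`, extended by `f 0 = 0` and `f i = M` for `i > N`. -/
structure IsPath (N M : ℕ) (f : ℕ → ℕ) : Prop where
  zero : f 0 = 0
  mono : Monotone f
  eq_top : ∀ i, N < i → f i = M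

theorem IsPath.le {N M : ℕ} {f : ℕ → ℕ} (h : IsPath N M f) (i : ℕ) : f i ≤ M := by
  rw [← h.eq_top (max i (N + 1)) (by omega)]
  exact h.mono (by omega)

theorem finite_isPath (N M : ℕ) : {f | IsPath N M f}.Finite := by
  refine (Set.finite_range fun (p : Fin (N + 1) → Fin (M + 1)) (i : ℕ) =>
    if h : i < N + 1 then (p ⟨i, h⟩ : ℕ) else M).subset fun f hf => ?_
  refine ⟨fun i => ⟨f i, Nat.lt_succ_of_le (hf.le i)⟩, funext fun i => ?_⟩
  by_cases h : i < N + 1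
  · simp [h]
  · simp [h, hf.eq_top i (by omega)]

/-- The condition `h_i - f_{i+1-a} ≥ 1 - α` on a pair of extended partitions, for the subscripts in
`0 ≤ i ≤ N₂` and `1 ≤ i + 1 - a ≤ N₁ + 1` (here `j = i + 1 - a`). The extreme subscripts encode the
special conditions on restricted pairs. The lattice path of `h` then avoids a translate of that of
`f`. -/
def Above (N₁ N₂ a α : ℕ) (f h : ℕ → ℕ) : Prop :=
  ∀ i j, 1 ≤ j → j ≤ N₁ + 1 → i ≤ N₂ → j + a = i + 1 → f j < h i + α

/-- Restricted pairs of extended partitions in `(N₁, M₁) × (N₂, M₂)`. -/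
def pairSet (a b α β N₁ M₁ N₂ M₂ : ℕ) : Set ((ℕ → ℕ) × (ℕ → ℕ)) :=
  {π | IsPath N₁ M₁ π.1 ∧ IsPath N₂ M₂ π.2 ∧ Above N₁ N₂ a α π.1 π.2 ∧ Above N₂ N₁ b β π.2 π.1}

theorem finite_pairSet (a b α β N₁ M₁ N₂ M₂ : ℕ) : (pairSet a b α β N₁ M₁ N₂ M₂).Finite :=
  ((finite_isPath N₁ M₁).prod (finite_isPath N₂ M₂)).subset fun _ h => ⟨h.1, h.2.1⟩

/-- The weight of an extended partition. -/
def pathWt (N : ℕ) (f : ℕ → ℕ) : ℕ := ∑ i ∈ Finset.Icc 1 N, f i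

/-- The generating function of restricted pairs of extended partitions. -/
noncomputable def pairGen {A : Type*} [CommSemiring A] (q : A) (a b α β N₁ M₁ N₂ M₂ : ℕ) : A :=
  ∑ᶠ π ∈ pairSet a b α β N₁ M₁ N₂ M₂, q ^ (pathWt N₁ π.1 + pathWt N₂ π.2)

/-- The generating function of all extended partitions. -/
noncomputable def pathGen {A : Type*} [CommSemiring A] (q : A) (N M : ℕ) : A :=
  ∑ᶠ f ∈ {f | IsPath N M f}, q ^ pathWt N f

/-- The extended partition that has the parts `f 1, …, f N` and the value `M` beyond them. It moves
an extended partition whose parts are at most `M` from `(N, M')` to `(N, M)`. -/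
def cap (N M : ℕ) (f : ℕ → ℕ) (i : ℕ) : ℕ := if i ≤ N then f i else M

theorem cap_of_le {N M i : ℕ} (f : ℕ → ℕ) (h : i ≤ N) : cap N M f i = f i := if_pos h

theorem pathWt_cap (N M : ℕ) (f : ℕ → ℕ) : pathWt N (cap N M f) = pathWt N f :=
  Finset.sum_congr rfl fun _ hi => cap_of_le f (Finset.mem_Icc.1 hi).2

theorem cap_cap (N M M' : ℕ) (f : ℕ → ℕ) : cap N M (cap N M' f) = cap N M f := by
  funext i
  unfold cap
  split_ifs <;> rfl

theorem IsPath.cap_eq {N M : ℕ} {f : ℕ → ℕ} (h : IsPath N M f) : cap N M f = f := by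
  funext i
  unfold cap
  split_ifs with hi
  · rfl
  · exact (h.eq_top i (by omega)).symm

theorem IsPath.cap {N M M' : ℕ} {f : ℕ → ℕ} (h : IsPath N M f) (hM : f N ≤ M') :
    IsPath N M' (cap N M' f) where
  zero := by rw [cap_of_le f (Nat.zero_le N), h.zero]
  mono i j hij := by
    unfold BurgeTree.cap
    split_ifs with hi hj hj
    · exact h.mono hij
    · exact (h.mono hi).trans hM
    · omega
    · exact le_rfl
  eq_top _ hi := if_neg (by omega)

theorem isPath_iff_of_eq {N M : ℕ} {f : ℕ → ℕ} :
    IsPath N M f ↔ IsPath (N + 1) M f ∧ f (N + 1) = M := by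
  constructor
  · intro h
    exact ⟨⟨h.zero, h.mono, fun i hi => h.eq_top i (by omega)⟩, h.eq_top _ (by omega)⟩
  · rintro ⟨h, h'⟩
    refine ⟨h.zero, h.mono, fun i hi => ?_⟩
    rcases Nat.lt_or_ge (N + 1) i with hi' | hi'
    · exact h.eq_top i hi'
    · rwa [show i = N + 1 by omega]

theorem pathWt_succ (N : ℕ) (f : ℕ → ℕ) : pathWt (N + 1) f = pathWt N f + f (N + 1) :=
  Finset.sum_Icc_succ_top (by omega) f

section Recurrences

variable {A : Type*} [CommSemiring A] (q : A)

theorem finsum_path_split {X : Type*} {S S₁ S₂ : Set X} (hS : S.Finite) {W W₁ W₂ : X → A}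
    (P : X → Prop) (e : X → X) (h₁ : Set.BijOn e (S ∩ {x | P x}) S₁)
    (hw₁ : ∀ x ∈ S, P x → W x = W₁ (e x)) (h₂ : ∀ x, x ∈ S ∧ ¬ P x ↔ x ∈ S₂)
    (hw₂ : ∀ x ∈ S₂, W x = W₂ x) :
    ∑ᶠ x ∈ S, W x = ∑ᶠ x ∈ S₁, W₁ x + ∑ᶠ x ∈ S₂, W₂ x := by
  rw [← finsum_mem_inter_add_sdiff {x | P x} hS]
  congr 1
  · exact finsum_mem_eq_of_bijOn e h₁ fun x hx => hw₁ x hx.1 hx.2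
  · exact finsum_mem_congr (Set.ext h₂) hw₂

theorem bijOn_cap (N M : ℕ) :
    Set.BijOn (cap N M) ({f | IsPath N (M + 1) f} ∩ {f | f N ≤ M}) {f | IsPath N M f} := by
  refine ⟨fun f hf => hf.1.cap hf.2, fun f hf g hg h => ?_,
    fun f hf => ⟨cap N (M + 1) f, ⟨?_, ?_⟩, ?_⟩⟩
  · rw [← hf.1.cap_eq, ← hg.1.cap_eq, ← cap_cap N (M + 1) M f, h, cap_cap]
  · exact IsPath.cap hf ((hf.le N).trans (Nat.le_succ M))
  · change cap N (M + 1) f N ≤ M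
    rw [cap_of_le f le_rfl]
    exact hf.le N
  · rw [cap_cap, hf.cap_eq]

theorem setOf_isPath_zero_left (M : ℕ) :
    {f | IsPath 0 M f} = {fun i => if i = 0 then 0 else M} := by
  ext f
  simp only [Set.mem_ofPred_eq, Set.mem_singleton_iff]
  constructor
  · intro hf
    funext i
    split_ifs with hi
    · rw [hi, hf.zero]
    · exact hf.eq_top i (by omega)
  · rintro rfl
    refine ⟨by simp, fun i j hij => ?_, fun i hi => if_neg (by omega)⟩
    split_ifs <;> omega

theorem setOf_isPath_zero_right (N : ℕ) : {f | IsPath N 0 f} = {fun _ => 0} := by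
  ext f
  simp only [Set.mem_ofPred_eq, Set.mem_singleton_iff]
  constructor
  · intro hf
    funext i
    exact Nat.le_zero.1 (hf.le i)
  · rintro rfl
    exact ⟨rfl, monotone_const, fun _ _ => rfl⟩

theorem pathGen_zero_left (M : ℕ) : pathGen q 0 M = 1 := by
  rw [pathGen, setOf_isPath_zero_left, finsum_mem_singleton]
  simp [pathWt]

theorem pathGen_zero_right (N : ℕ) : pathGen q N 0 = 1 := by
  rw [pathGen, setOf_isPath_zero_right, finsum_mem_singleton]
  simp [pathWt]

theorem pathGen_succ_succ (N M : ℕ) : pathGen q (N + 1) (M + 1) =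
    pathGen q (N + 1) M + q ^ (M + 1) * pathGen q N (M + 1) := by
  rw [pathGen, pathGen, pathGen, mul_finsum_mem' _ _ (finite_isPath _ _)]
  refine finsum_path_split (finite_isPath _ _) (fun f => f (N + 1) ≤ M) (cap (N + 1) M)
    (bijOn_cap _ _) (fun f _ _ => by rw [pathWt_cap]) (fun f => ?_) (fun f hf => ?_)
  · simp only [Set.mem_ofPred_eq, isPath_iff_of_eq (N := N)]
    refine and_congr_right fun hf => ?_
    have := hf.le (N + 1)
    omega
  · rw [pathWt_succ, (isPath_iff_of_eq.1 hf).2, pow_add, mul_comm]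

theorem pathGen_eq_boxGen : ∀ N M : ℕ, pathGen q N M = boxGen q N M
  | 0, M => by rw [pathGen_zero_left, boxGen_zero_left]
  | N + 1, 0 => by rw [pathGen_zero_right, boxGen_zero_right]
  | N + 1, M + 1 => by
    rw [pathGen_succ_succ, boxGen_succ_succ, pathGen_eq_boxGen (N + 1) M,
      pathGen_eq_boxGen N (M + 1)]

theorem pairSet_succ_iff {a b α β N₁ M₁ N₂ M₂ : ℕ} (hN : N₂ < N₁ + 1 + a) (hM : M₂ < M₁ + β)
    (π : (ℕ → ℕ) × (ℕ → ℕ)) :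
    (π ∈ pairSet a b α β (N₁ + 1) M₁ N₂ M₂ ∧ π.1 (N₁ + 1) = M₁) ↔
      π ∈ pairSet a b α β N₁ M₁ N₂ M₂ := by
  obtain ⟨f, h⟩ := π
  simp only [pairSet, Set.mem_ofPred_eq, isPath_iff_of_eq (N := N₁)]
  constructor
  · rintro ⟨⟨hf, hh, habove, habove'⟩, htop⟩
    exact ⟨⟨hf, htop⟩, hh, fun i j hj hj' hi hij => habove i j hj (by omega) hi hij,
      fun i j hj hj' hi hij => habove' i j hj hj' (by omega) hij⟩
  · rintro ⟨⟨hf, htop⟩, hh, habove, habove'⟩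
    refine ⟨⟨hf, hh, fun i j hj hj' hi hij => habove i j hj (by omega) hi hij,
      fun i j hj hj' hi hij => ?_⟩, htop⟩
    rcases Nat.lt_or_ge N₁ i with hi' | hi'
    · rw [show i = N₁ + 1 by omega, htop]
      exact (hh.le j).trans_lt hM
    · exact habove' i j hj hj' hi' hij

theorem bijOn_cap_pair {a b α β N₁ M₁ N₂ M₂ : ℕ} (hN : N₂ < N₁ + a) :
    Set.BijOn (Prod.map (cap N₁ M₁) id)
      (pairSet a b α β N₁ (M₁ + 1) N₂ M₂ ∩ {π | π.1 N₁ ≤ M₁}) (pairSet a b α β N₁ M₁ N₂ M₂) := by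
  have above_cap : ∀ (M : ℕ) (f h : ℕ → ℕ), Above N₁ N₂ a α f h → Above N₁ N₂ a α (cap N₁ M f) h :=
    fun M f h habove i j hj hj' hi hij => by
      rw [cap_of_le f (by omega)]
      exact habove i j hj hj' hi hij
  have cap_above : ∀ (M : ℕ) (f h : ℕ → ℕ), Above N₂ N₁ b β h f → Above N₂ N₁ b β h (cap N₁ M f) :=
    fun M f h habove i j hj hj' hi hij => by
      rw [cap_of_le f hi]
      exact habove i j hj hj' hi hij
  refine ⟨fun π hπ => ⟨hπ.1.1.cap hπ.2, hπ.1.2.1, above_cap _ _ _ hπ.1.2.2.1,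
    cap_above _ _ _ hπ.1.2.2.2⟩, fun π hπ ρ hρ h => ?_, fun π hπ => ?_⟩
  · have hfst := congrArg Prod.fst h
    have hsnd := congrArg Prod.snd h
    exact Prod.ext ((bijOn_cap N₁ M₁).injOn ⟨hπ.1.1, hπ.2⟩ ⟨hρ.1.1, hρ.2⟩ hfst) hsnd
  · refine ⟨(cap N₁ (M₁ + 1) π.1, π.2), ⟨⟨hπ.1.cap ((hπ.1.le N₁).trans (Nat.le_succ _)), hπ.2.1,
      above_cap _ _ _ hπ.2.2.1, cap_above _ _ _ hπ.2.2.2⟩, ?_⟩, ?_⟩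
    · change cap N₁ (M₁ + 1) π.1 N₁ ≤ M₁
      rw [cap_of_le _ le_rfl]
      exact hπ.1.le N₁
    · refine Prod.ext ?_ rfl
      change cap N₁ M₁ (cap N₁ (M₁ + 1) π.1) = π.1
      rw [cap_cap, hπ.1.cap_eq]

theorem pairGen_succ_succ {a b α β N₁ M₁ N₂ M₂ : ℕ} (hN : N₂ < N₁ + 1 + a)
    (hM : M₂ < M₁ + 1 + β) :
    pairGen q a b α β (N₁ + 1) (M₁ + 1) N₂ M₂ = pairGen q a b α β (N₁ + 1) M₁ N₂ M₂ +
      q ^ (M₁ + 1) * pairGen q a b α β N₁ (M₁ + 1) N₂ M₂ := by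
  rw [pairGen, pairGen, pairGen, mul_finsum_mem' _ _ (finite_pairSet _ _ _ _ _ _ _ _)]
  refine finsum_path_split (finite_pairSet _ _ _ _ _ _ _ _) (fun π => π.1 (N₁ + 1) ≤ M₁) _
    (bijOn_cap_pair hN) (fun π _ _ => ?_) (fun π => ?_) (fun π hπ => ?_)
  · simp [pathWt_cap]
  · rw [← pairSet_succ_iff hN hM]
    refine and_congr_right fun hπ => ?_
    have := hπ.1.le (N₁ + 1)
    omega
  · rw [pathWt_succ, ((pairSet_succ_iff hN hM π).2 hπ).2]
    ring

theorem pairGen_zero_succ {a b α β M₁ N₂ M₂ : ℕ} (hN : N₂ < a) :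
    pairGen q a b α β 0 (M₁ + 1) N₂ M₂ = pairGen q a b α β 0 M₁ N₂ M₂ := by
  rw [pairGen, pairGen]
  refine finsum_mem_eq_of_bijOn (Prod.map (cap 0 M₁) id) ?_ (fun π _ => by simp [pathWt_cap])
  have h := bijOn_cap_pair (b := b) (α := α) (β := β) (M₁ := M₁) (M₂ := M₂)
    (show N₂ < 0 + a by omega)
  rwa [Set.inter_eq_left.2] at h
  intro π hπ
  simp [hπ.1.zero]

theorem pairGen_succ_zero {a b α β N₁ N₂ M₂ : ℕ} (hN : N₂ < N₁ + 1 + a) (hM : M₂ < β) :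
    pairGen q a b α β (N₁ + 1) 0 N₂ M₂ = pairGen q a b α β N₁ 0 N₂ M₂ := by
  rw [pairGen, pairGen]
  have h := pairSet_succ_iff (b := b) (α := α) hN (show M₂ < 0 + β by omega)
  refine finsum_mem_congr (Set.ext fun π => ?_) (fun π hπ => ?_)
  · rw [← h]
    exact ⟨fun hπ => ⟨hπ, Nat.le_zero.1 (hπ.1.le _)⟩, fun hπ => hπ.1⟩
  · rw [pathWt_succ, ((h π).2 hπ).2]
    rfl

theorem pairGen_zero_zero {a b α β N₂ M₂ : ℕ} (hN : N₂ < a) (hM : M₂ < β) :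
    pairGen q a b α β 0 0 N₂ M₂ = boxGen q N₂ M₂ := by
  rw [← pathGen_eq_boxGen, pathGen, pairGen]
  refine finsum_mem_eq_of_bijOn Prod.snd ⟨fun π hπ => hπ.2.1, fun π hπ ρ hρ h => ?_,
    fun f hf => ?_⟩ (fun π _ => by simp [pathWt])
  · refine Prod.ext (funext fun i => ?_) h
    rw [Nat.le_zero.1 (hπ.1.le i), Nat.le_zero.1 (hρ.1.le i)]
  · refine ⟨(fun _ => 0, f), ⟨⟨rfl, monotone_const, fun _ _ => rfl⟩, hf, ?_, ?_⟩, rfl⟩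
    · intro i j _ _ _ _
      omega
    · intro i j _ _ _ _
      exact (hf.le j).trans_lt (by simpa using hM)

theorem pairGen_swap (a b α β N₁ M₁ N₂ M₂ : ℕ) :
    pairGen q a b α β N₁ M₁ N₂ M₂ = pairGen q b a β α N₂ M₂ N₁ M₁ := by
  rw [pairGen, pairGen]
  refine finsum_mem_eq_of_bijOn Prod.swap ⟨fun π hπ => ⟨hπ.2.1, hπ.1, hπ.2.2.2, hπ.2.2.1⟩,
    Prod.swap_injective.injOn, fun π hπ => ⟨π.swap, ⟨hπ.2.1, hπ.1, hπ.2.2.2, hπ.2.2.1⟩,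
      Prod.swap_swap π⟩⟩ (fun π _ => ?_)
  simp [add_comm]

theorem pairGen_eq_zero {a b α β N₁ M₁ N₂ M₂ : ℕ} (hN : N₂ = N₁ + a) (hM : M₁ = M₂ + α) :
    pairGen q a b α β N₁ M₁ N₂ M₂ = 0 := by
  rw [pairGen, finsum_mem_congr (t := ∅) _ fun _ _ => rfl, finsum_mem_empty]
  refine Set.eq_empty_of_forall_notMem fun π hπ => ?_
  have := hπ.2.2.1 N₂ (N₁ + 1) (by omega) le_rfl le_rfl (by omega)
  rw [hπ.1.eq_top _ (by omega)] at this
  have := hπ.2.1.le N₂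
  omega

theorem map_pairGen {A' : Type*} [CommSemiring A'] (φ : A →+* A') (a b α β N₁ M₁ N₂ M₂ : ℕ) :
    φ (pairGen q a b α β N₁ M₁ N₂ M₂) = pairGen (φ q) a b α β N₁ M₁ N₂ M₂ := by
  refine (φ.toAddMonoidHom.map_finsum_mem _ (finite_pairSet _ _ _ _ _ _ _ _)).trans ?_
  simp [pairGen]

end Recurrences

section BosonicForm

variable {F : Type*} [Field F] {q : F}

theorem pairGen_eq_bosonicSum_of_shorter (hq : q ≠ 0) {a b α β N₁ M₁ N₂ M₂ : ℕ}
    (hN : N₂ < N₁ + a) (hM : M₂ < M₁ + β) (hMα : M₁ ≤ M₂ + α) (hNb : N₁ ≤ N₂ + b)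
    (ih : ∀ N M : ℕ, N + M < N₁ + M₁ → N ≤ N₁ → M ≤ M₁ → N₂ ≤ N + a → M₂ ≤ M + β →
      pairGen q a b α β N M N₂ M₂ = bosonicSum q (a + b) (α + β) a α N M N₂ M₂) :
    pairGen q a b α β N₁ M₁ N₂ M₂ = bosonicSum q (a + b) (α + β) a α N₁ M₁ N₂ M₂ := by
  by_cases hpos : N₁ = 0 ∧ M₁ = 0
  · obtain ⟨rfl, rfl⟩ := hpos
    rw [pairGen_zero_zero q (by omega) (by omega), Nat.cast_zero,
      bosonicSum_zero_zero (by omega) (by omega) (by omega) (by omega), intBox_natCast]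
  rw [bosonicSum_eq_last hq (by omega) (by omega) (by omega) (by omega) (by omega) (by omega)
    (by omega) (by omega) (by omega)]
  match N₁, M₁ with
  | 0, M₁ + 1 =>
    rw [Nat.cast_zero, zero_sub, bosonicSum_neg_one_left (by omega) (by omega) (by omega),
      pairGen_zero_succ q (by omega),
      ih 0 M₁ (by omega) (by omega) (by omega) (by omega) (by omega)]
    simp
  | N₁ + 1, 0 =>
    rw [Nat.cast_zero, zero_sub, bosonicSum_neg_one_right (by omega) (by omega) (by omega),
      pairGen_succ_zero q (by omega) (by omega),
      ih N₁ 0 (by omega) (by omega) (by omega) (by omega) (by omega)]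
    simp
  | N₁ + 1, M₁ + 1 =>
    rw [pairGen_succ_succ q (by omega) (by omega),
      ih N₁ (M₁ + 1) (by omega) (by omega) (by omega) (by omega) (by omega),
      ih (N₁ + 1) M₁ (by omega) (by omega) (by omega) (by omega) (by omega), zpow_natCast]
    simp

theorem pairGen_eq_bosonicSum (hq : q ≠ 0) {a b α β : ℕ} (hK : 0 < a + b) (hκ : 0 < α + β)
    (N₁ M₁ N₂ M₂ : ℕ) (hNa : N₂ ≤ N₁ + a) (hMα : M₁ ≤ M₂ + α) (hNb : N₁ ≤ N₂ + b)
    (hMβ : M₂ ≤ M₁ + β) :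
    pairGen q a b α β N₁ M₁ N₂ M₂ = bosonicSum q (a + b) (α + β) a α N₁ M₁ N₂ M₂ := by
  obtain ⟨D, hD⟩ : ∃ D, N₁ + M₁ + N₂ + M₂ = D := ⟨_, rfl⟩
  induction D using Nat.strong_induction_on generalizing a b α β N₁ M₁ N₂ M₂ with
  | _ D ih =>
  have hswap : bosonicSum q (a + b) (α + β) a α N₁ M₁ N₂ M₂ =
      bosonicSum q (b + a) (β + α) b β N₂ M₂ N₁ M₁ := by
    rw [bosonicSum_swap (by omega), add_sub_cancel_left, add_sub_cancel_left, add_comm (b : ℤ),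
      add_comm (β : ℤ)]
  have hcases : (N₂ = N₁ + a ∧ M₁ = M₂ + α) ∨ (N₁ = N₂ + b ∧ M₂ = M₁ + β) ∨
      (N₂ < N₁ + a ∧ M₂ < M₁ + β) ∨ (N₁ < N₂ + b ∧ M₁ < M₂ + α) := by omega
  rcases hcases with hend | hend | hlt | hlt
  · rw [pairGen_eq_zero q hend.1 hend.2, bosonicSum_eq_zero_of_end (by omega) (by omega)]
  · rw [pairGen_swap, pairGen_eq_zero q hend.1 hend.2, hswap,
      bosonicSum_eq_zero_of_end (by omega) (by omega)]
  · refine pairGen_eq_bosonicSum_of_shorter hq hlt.1 hlt.2 hMα hNb fun N M hlt' hN hM hNa hMβ => ?_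
    exact ih _ (by omega) hK hκ N M N₂ M₂ hNa (by omega) (by omega) hMβ rfl
  · rw [pairGen_swap, hswap]
    refine pairGen_eq_bosonicSum_of_shorter hq hlt.1 hlt.2 hMβ hNa fun N M hlt' hN hM hNb hMα => ?_
    exact ih _ (by omega) (by omega) (by omega) N M N₁ M₁ hNb (by omega) (by omega) hMα rfl

end BosonicForm

/-- The extension of a partition in `(N, M)` by `p_0 = 0` and `p_i = M` for `i > N`. -/
def extend {N M : ℕ} (p : BoxSeq N M) (i : ℕ) : ℕ :=
  if i = 0 then 0 else if h : i - 1 < N then p ⟨i - 1, h⟩ else M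

theorem entry_eq_extend {N M : ℕ} (p : BoxSeq N M) (i : ℕ) : entry p i = extend p i := by
  unfold entry extend
  split_ifs <;> simp

theorem extend_zero {N M : ℕ} (p : BoxSeq N M) : extend p 0 = 0 := if_pos rfl

theorem extend_succ {N M : ℕ} (p : BoxSeq N M) (i : Fin N) : extend p (i + 1) = p i := by
  simp [extend]

theorem extend_of_lt {N M i : ℕ} (p : BoxSeq N M) (h : N < i) : extend p i = M := by
  rw [extend, if_neg (by omega), dif_neg (by omega)]

theorem isPath_extend {N M : ℕ} {p : BoxSeq N M} (h : Monotone p) : IsPath N M (extend p) where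
  zero := extend_zero p
  mono i j hij := by
    unfold extend
    split_ifs
    any_goals omega
    exact h (by simp only [Fin.mk_le_mk]; omega)
  eq_top _ hi := extend_of_lt p hi

theorem extend_injective {N M : ℕ} : Function.Injective (extend (N := N) (M := M)) := by
  intro p p' h
  funext i
  have hi := congrFun h (i + 1)
  rw [extend_succ, extend_succ] at hi
  exact Fin.ext hi

theorem IsPath.exists_extend {N M : ℕ} {f : ℕ → ℕ} (h : IsPath N M f) :
    ∃ p : BoxSeq N M, Monotone p ∧ extend p = f := by
  refine ⟨fun i => ⟨f (i + 1), Nat.lt_succ_of_le (h.le _)⟩, fun i j hij => ?_, funext fun i => ?_⟩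
  · exact h.mono (by simpa using hij)
  · rcases Nat.eq_zero_or_pos i with rfl | hi
    · rw [extend_zero, h.zero]
    · unfold extend
      rw [if_neg (by omega)]
      split_ifs
      · simp only
        congr 1
        omega
      · exact (h.eq_top i (by omega)).symm

theorem pathWt_extend {N M : ℕ} (p : BoxSeq N M) : pathWt N (extend p) = boxWt p := by
  rw [pathWt, ← Finset.Ico_add_one_right_eq_Icc, Finset.sum_Ico_eq_sum_range, Nat.add_sub_cancel,
    ← Fin.sum_univ_eq_sum_range (fun i => extend p (1 + i))]
  exact Finset.sum_congr rfl fun i _ => by rw [add_comm, extend_succ]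

theorem above_extend_iff {N₁ M₁ N₂ M₂ a α : ℕ} (ha : N₂ ≤ N₁ + a) (q : BoxSeq N₁ M₁)
    (p : BoxSeq N₂ M₂) :
    Above N₁ N₂ a α (extend q) (extend p) ↔
      (∀ i j : ℕ, 1 ≤ i → i ≤ N₂ → 1 ≤ j → j ≤ N₁ → j + a = i + 1 →
        entry p i - entry q j ≥ 1 - (α : ℤ)) ∧
      (a = 0 → entry q 1 ≤ (α : ℤ) - 1) ∧
      ((a : ℤ) = (N₂ : ℤ) - N₁ → entry p N₂ ≥ (M₁ : ℤ) - α + 1) := by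
  simp only [entry_eq_extend]
  constructor
  · intro habove
    refine ⟨fun i j _ hi hj hj' hij => ?_, fun ha₀ => ?_, fun hend => ?_⟩
    · have := habove i j hj (by omega) hi hij
      omega
    · have := habove 0 1 le_rfl (by omega) (by omega) (by omega)
      rw [extend_zero] at this
      omega
    · have := habove N₂ (N₁ + 1) (by omega) le_rfl le_rfl (by omega)
      rw [extend_of_lt q (by omega)] at this
      omega
  · rintro ⟨hinner, hstart, hend⟩ i j hj hj' hi hij
    rcases Nat.eq_zero_or_pos i with rfl | hi₀
    · have := hstart (by omega)
      rw [show j = 1 by omega, extend_zero]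
      omega
    rcases Nat.lt_or_ge N₁ j with hlt | hle
    · have := hend (by omega)
      rw [extend_of_lt q hlt, show i = N₂ by omega]
      omega
    · have := hinner i j hi₀ hi hj hle hij
      omega

theorem isRestricted_iff {N₁ M₁ N₂ M₂ a b α β : ℕ} (ha : N₂ ≤ N₁ + a) (hb : N₁ ≤ N₂ + b)
    (q : BoxSeq N₁ M₁) (p : BoxSeq N₂ M₂) :
    IsRestricted N₁ M₁ N₂ M₂ a b α β q p ↔ Monotone q ∧ Monotone p ∧
      Above N₁ N₂ a α (extend q) (extend p) ∧ Above N₂ N₁ b β (extend p) (extend q) := by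
  rw [above_extend_iff ha, above_extend_iff hb]
  exact ⟨fun h => ⟨h.monotone_q, h.monotone_p, ⟨h.first, h.special_a, h.special_a'⟩,
      h.second, h.special_b, h.special_b'⟩,
    fun ⟨hq, hp, ⟨hfirst, hsa, hsa'⟩, hsecond, hsb, hsb'⟩ =>
      ⟨hq, hp, hfirst, hsecond, hsa, hsb, hsa', hsb'⟩⟩

theorem genFun_eq_pairGen {N₁ M₁ N₂ M₂ a b α β : ℕ} (ha : N₂ ≤ N₁ + a) (hb : N₁ ≤ N₂ + b) :
    genFun N₁ M₁ N₂ M₂ a b α β = pairGen PowerSeries.X a b α β N₁ M₁ N₂ M₂ := by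
  classical
  rw [genFun, ← finsum_mem_coe_finset, pairGen]
  refine finsum_mem_eq_of_bijOn (Prod.map extend extend) ⟨fun π hπ => ?_, ?_, fun π hπ => ?_⟩
    (fun π _ => by simp [pathWt_extend])
  · have h := (isRestricted_iff ha hb π.1 π.2).1 (Finset.mem_filter.1 hπ).2
    exact ⟨isPath_extend h.1, isPath_extend h.2.1, h.2.2⟩
  · exact (Prod.map_injective.2 ⟨extend_injective, extend_injective⟩).injOn
  · obtain ⟨q, hq, hq'⟩ := hπ.1.exists_extend
    obtain ⟨p, hp, hp'⟩ := hπ.2.1.exists_extend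
    refine ⟨(q, p), Finset.mem_filter.2
      ⟨Finset.mem_univ _, (isRestricted_iff ha hb q p).2 ⟨hq, hp, ?_⟩⟩, Prod.ext hq' hp'⟩
    rw [hq', hp']
    exact hπ.2.2

/-! ### The Burge recurrence -/

/-- The series `R(N, M, a, b, α, β)` with the variable specialised to an element `q` of any
semiring. -/
noncomputable def squareGen {A : Type*} [CommSemiring A] (q : A) (N M a b α β : ℕ) : A :=
  pairGen q a b α β N M N M

theorem R_eq_squareGen (N M a b α β : ℕ) : R N M a b α β = squareGen PowerSeries.X N M a b α β :=
  genFun_eq_pairGen (Nat.le_add_right N a) (Nat.le_add_right N b)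

section Domain

variable {A : Type*} [CommRing A] [IsDomain A] {q : A}

theorem algebraMap_squareGen (hq : q ≠ 0) {a b α β : ℕ} (hK : 0 < a + b) (hκ : 0 < α + β)
    (N M : ℕ) :
    algebraMap A (FractionRing A) (squareGen q N M a b α β) =
      bosonicSum (algebraMap A (FractionRing A) q) (a + b) (α + β) a α N M N M := by
  have hq' : algebraMap A (FractionRing A) q ≠ 0 :=
    (map_ne_zero_iff _ (IsFractionRing.injective A (FractionRing A))).2 hq
  rw [squareGen, map_pairGen]
  exact pairGen_eq_bosonicSum hq' hK hκ N M N M (by omega) (by omega) (by omega) (by omega)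

theorem squareGen_transpose (hq : q ≠ 0) {a b α β : ℕ} (hK : 0 < a + b) (hκ : 0 < α + β)
    (N M : ℕ) : squareGen q N M a b α β = squareGen q M N α β a b := by
  apply IsFractionRing.injective A (FractionRing A)
  rw [algebraMap_squareGen hq hK hκ, algebraMap_squareGen hq hκ hK,
    bosonicSum_transpose (by omega) (by omega)]

theorem squareGen_burge (hq : q ≠ 0) {a b α β : ℕ} (hK : 0 < a + b) (hκ : 0 < α + β) (N M : ℕ) :
    squareGen q N M a b (α + a) (β + b) = ∑ n ∈ Finset.range (min N M + 1),
      q ^ (n ^ 2) * boxGen q (N - n) (2 * M) * squareGen q n (M - n) a b α β := by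
  have hinj := IsFractionRing.injective A (FractionRing A)
  apply hinj
  have hburge := bosonicSum_burge ((map_ne_zero_iff _ hinj).2 hq) (K := a + b) (κ := α + β)
    (a := a) (α := α) (by omega) (by omega) (by omega) (by omega) (by omega) N M
  rw [algebraMap_squareGen hq hK (by omega), map_sum,
    show ((α + a : ℕ) : ℤ) + (β + b : ℕ) = α + β + (a + b) by push_cast; ring, Nat.cast_add α a,
    hburge]
  symm
  refine Finset.sum_subset_zero_on_sdiff (Finset.range_subset_range.2 (by omega)) (fun n hn => ?_)
    (fun n hn => ?_)
  · simp only [Finset.mem_sdiff, Finset.mem_range] at hn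
    rw [intBox_of_neg_left _ (by omega), mul_zero, zero_mul]
  · rw [Finset.mem_range] at hn
    rw [map_mul, map_mul, map_boxGen, algebraMap_squareGen hq hK hκ, map_pow,
      Nat.cast_sub (by omega), ← Nat.cast_sub (show n ≤ N by omega),
      show (2 * M : ℤ) = (2 * M : ℕ) by push_cast; rfl, intBox_natCast, ← Nat.cast_pow,
      zpow_natCast]

theorem squareGen_one_zero (hq : q ≠ 0) (b β N M : ℕ) :
    squareGen q N (M + 1) 1 b 0 (β + 1) = q ^ N * squareGen q N M 1 b 1 β := by
  have hinj := IsFractionRing.injective A (FractionRing A)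
  apply hinj
  have h := bosonicSum_one_zero ((map_ne_zero_iff _ hinj).2 hq) (K := 1 + b) (κ := β + 1) (N := N)
    (M := M) (by omega) (by omega) (by omega) (by omega)
  rw [map_mul, algebraMap_squareGen hq (by omega) (by omega),
    algebraMap_squareGen hq (by omega) (by omega)]
  push_cast
  rw [zero_add, h, add_comm (1 : ℤ) β]
  simp

theorem squareGen_zero_one (hq : q ≠ 0) (b β N M : ℕ) :
    squareGen q (N + 1) M 0 (b + 1) 1 β = q ^ M * squareGen q N M 1 b 1 β := by
  rw [squareGen_transpose hq (by omega) (by omega), squareGen_one_zero hq,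
    squareGen_transpose hq (by omega) (by omega)]

end Domain

section Boundary

variable {A : Type*} [CommSemiring A] (q : A)

theorem squareGen_eq_zero {N M a b α β : ℕ} (h : ∀ π, π ∉ pairSet a b α β N M N M) :
    squareGen q N M a b α β = 0 := by
  rw [squareGen, pairGen, Set.eq_empty_of_forall_notMem h, finsum_mem_empty]

theorem squareGen_eq_one {N a b α β : ℕ} (h : ((fun _ => 0, fun _ => 0) : (ℕ → ℕ) × (ℕ → ℕ)) ∈
    pairSet a b α β N 0 N 0) : squareGen q N 0 a b α β = 1 := by
  have hset : pairSet a b α β N 0 N 0 = {(fun _ => 0, fun _ => 0)} := by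
    refine Set.eq_singleton_iff_unique_mem.2 ⟨h, fun π hπ => Prod.ext ?_ ?_⟩
    · exact funext fun i => Nat.le_zero.1 (hπ.1.le i)
    · exact funext fun i => Nat.le_zero.1 (hπ.2.1.le i)
  rw [squareGen, pairGen, hset, finsum_mem_singleton]
  simp [pathWt]

theorem isPath_const_zero (N : ℕ) : IsPath N 0 fun _ => 0 :=
  ⟨rfl, monotone_const, fun _ _ => rfl⟩

theorem squareGen_one_zero_zero_right (b N : ℕ) {β : ℕ} (hβ : 0 < β) :
    squareGen q N 0 1 b 0 β = if N = 0 then 1 else 0 := by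
  split_ifs with hN
  · subst hN
    exact squareGen_eq_one q ⟨isPath_const_zero 0, isPath_const_zero 0,
      fun i j _ _ _ _ => by omega, fun i j _ _ _ _ => by simpa using hβ⟩
  · refine squareGen_eq_zero q fun π hπ => ?_
    have hlt := hπ.2.2.1 1 1 le_rfl (by omega) (by omega) rfl
    have hle := hπ.2.1.le 1
    omega

theorem squareGen_zero_one_zero_left (β M : ℕ) {b : ℕ} (hb : 0 < b) :
    squareGen q 0 M 0 b 1 β = if M = 0 then 1 else 0 := by
  split_ifs with hM
  · subst hM
    exact squareGen_eq_one q ⟨isPath_const_zero 0, isPath_const_zero 0,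
      fun i j _ _ _ _ => by simp, fun i j _ _ _ _ => by omega⟩
  · refine squareGen_eq_zero q fun π hπ => hM ?_
    have hlt := hπ.2.2.1 0 1 le_rfl le_rfl le_rfl rfl
    rw [hπ.1.eq_top 1 one_pos, hπ.2.1.zero] at hlt
    omega

theorem squareGen_zero_one_one_one (N M : ℕ) :
    squareGen q N M 0 1 1 1 = if M = 0 then 1 else 0 := by
  split_ifs with hM
  · subst hM
    exact squareGen_eq_one q ⟨isPath_const_zero N, isPath_const_zero N,
      fun i j _ _ _ _ => by simp, fun i j _ _ _ _ => by simp⟩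
  · refine squareGen_eq_zero q fun π hπ => hM ?_
    have hzero : ∀ i, i ≤ N → π.1 (i + 1) = 0 := by
      intro i
      induction i with
      | zero =>
        intro _
        have hlt := hπ.2.2.1 0 1 le_rfl (by omega) (by omega) rfl
        rw [hπ.2.1.zero] at hlt
        exact Nat.lt_one_iff.1 hlt
      | succ i ih =>
        intro hi
        have hlt : π.1 (i + 1 + 1) < π.2 (i + 1) + 1 :=
          hπ.2.2.1 (i + 1) (i + 1 + 1) (by omega) (by omega) (by omega) rfl
        have hlt' : π.2 (i + 1) < π.1 (i + 1) + 1 :=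
          hπ.2.2.2 (i + 1) (i + 1) (by omega) (by omega) (by omega) rfl
        have hi' := ih (by omega)
        omega
    rw [← hzero N le_rfl, hπ.1.eq_top _ (by omega)]

/-- The series `q ^ (-M) R(N, M, 0, K, 1, κ - 1)`, which is again a polynomial in `q`. Its Burge
recurrence has the exponents `n (n - 1)` of the stages after the `u`-th. -/
noncomputable def reducedGen (N M K κ : ℕ) : A :=
  if N = 0 then (if M = 0 then 1 else 0) else squareGen q (N - 1) M 1 (K - 1) 1 (κ - 1)

theorem reducedGen_zero_left (M K κ : ℕ) : reducedGen q 0 M K κ = if M = 0 then 1 else 0 :=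
  if_pos rfl

theorem reducedGen_succ (N M K κ : ℕ) :
    reducedGen q (N + 1) M K κ = squareGen q N M 1 (K - 1) 1 (κ - 1) := by
  simp [reducedGen]

end Boundary

section Reduced

variable {A : Type*} [CommRing A] [IsDomain A] {q : A}

theorem pow_mul_reducedGen (hq : q ≠ 0) {K : ℕ} (hK : 0 < K) (N M κ : ℕ) :
    q ^ M * reducedGen q N M K κ = squareGen q N M 0 K 1 (κ - 1) := by
  cases N with
  | zero =>
    rw [squareGen_zero_one_zero_left q _ _ hK, reducedGen_zero_left]
    split_ifs with h <;> simp [h]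
  | succ N =>
    obtain ⟨K, rfl⟩ := Nat.exists_eq_succ_of_ne_zero hK.ne'
    rw [reducedGen_succ, squareGen_zero_one hq, Nat.succ_sub_one]

theorem reducedGen_transpose (hq : q ≠ 0) (N M K κ : ℕ) :
    reducedGen q (N + 1) M K κ = reducedGen q (M + 1) N κ K := by
  rw [reducedGen_succ, reducedGen_succ, squareGen_transpose hq (by omega) (by omega)]

theorem reducedGen_one_two (hq : q ≠ 0) (N M : ℕ) :
    reducedGen q N M 1 2 = if M = 0 then 1 else 0 := by
  have h := pow_mul_reducedGen hq one_pos N M 2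
  rw [squareGen_zero_one_one_one] at h
  split_ifs at h ⊢ with hM
  · simpa [hM] using h
  · exact (mul_eq_zero.1 h).resolve_left (pow_ne_zero _ hq)

theorem sq_add_sub_eq {n M : ℕ} (h : n ≤ M) : n ^ 2 + (M - n) = M + n * (n - 1) := by
  obtain ⟨m, rfl⟩ := Nat.exists_eq_add_of_le h
  cases n with
  | zero => simp
  | succ n =>
    rw [Nat.add_sub_cancel_left, Nat.add_sub_cancel]
    ring

theorem reducedGen_burge (hq : q ≠ 0) {K κ : ℕ} (hK : 0 < K) (hκ : 0 < κ) (N M : ℕ) :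
    reducedGen q N M K (κ + K) = ∑ n ∈ Finset.range (min N M + 1),
      q ^ (n * (n - 1)) * boxGen q (N - n) (2 * M) * reducedGen q n (M - n) K κ := by
  refine mul_left_cancel₀ (pow_ne_zero M hq) ?_
  have hburge := squareGen_burge hq (a := 0) (b := K) (α := 1) (β := κ - 1) (by omega) (by omega)
    N M
  rw [add_zero, ← Nat.sub_add_comm hκ] at hburge
  rw [pow_mul_reducedGen hq hK, hburge, Finset.mul_sum]
  refine Finset.sum_congr rfl fun n hn => ?_
  have hnM : n ≤ M := by
    have := Finset.mem_range.1 hn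
    omega
  rw [← pow_mul_reducedGen hq hK]
  calc q ^ n ^ 2 * boxGen q (N - n) (2 * M) * (q ^ (M - n) * reducedGen q n (M - n) K κ)
      = q ^ (n ^ 2 + (M - n)) * boxGen q (N - n) (2 * M) * reducedGen q n (M - n) K κ := by
        rw [pow_add]
        ring
    _ = q ^ M * (q ^ (n * (n - 1)) * boxGen q (N - n) (2 * M) * reducedGen q n (M - n) K κ) := by
        rw [sq_add_sub_eq hnM, pow_add]
        ring

end Reduced

/-! ### Continued fractions as iterated affine maps -/

/-- The pair whose continued fraction is `l` followed by that of `v`; the extension to arbitrary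
`v` is additive, which turns complementary pairs such as `(p' - s, p - r)` into values as well. -/
def cfVal (v : ℕ × ℕ) (l : List ℕ) : ℕ × ℕ := l.foldr (fun c v => (c * v.1 + v.2, v.1)) v

@[simp] theorem cfVal_nil (v : ℕ × ℕ) : cfVal v [] = v := rfl

@[simp] theorem cfVal_cons (v : ℕ × ℕ) (c : ℕ) (l : List ℕ) :
    cfVal v (c :: l) = (c * (cfVal v l).1 + (cfVal v l).2, (cfVal v l).1) := rfl

theorem cfVal_append (v : ℕ × ℕ) (l l' : List ℕ) : cfVal v (l ++ l') = cfVal (cfVal v l') l :=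
  List.foldr_append

theorem cfVal_add (v v' : ℕ × ℕ) (l : List ℕ) :
    cfVal (v + v') l = cfVal v l + cfVal v' l := by
  induction l with
  | nil => rfl
  | cons c l ih =>
    simp only [cfVal_cons, ih, Prod.fst_add, Prod.snd_add, Prod.mk_add_mk]
    congr 1
    ring

theorem cfVal_pos {v : ℕ × ℕ} (hfst : 0 < v.1) (hsnd : 0 < v.2) (l : List ℕ) :
    0 < (cfVal v l).1 ∧ 0 < (cfVal v l).2 := by
  induction l with
  | nil => exact ⟨hfst, hsnd⟩
  | cons c l ih => exact ⟨Nat.add_pos_right _ ih.2, ih.1⟩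

theorem cfVal_contFrac {s r : ℕ} (hs : 0 < s) (hsr : Nat.Coprime s r) :
    cfVal (1, 0) (contFrac s r) = (s, r) := by
  induction r using Nat.strong_induction_on generalizing s with
  | _ r ih =>
  cases r with
  | zero => rw [contFrac, cfVal_nil, (Nat.coprime_zero_right s).1 hsr]
  | succ r =>
    have hmod : Nat.Coprime (r + 1) (s % (r + 1)) := by
      rw [Nat.coprime_comm, Nat.Coprime, ← Nat.gcd_rec, Nat.gcd_comm]
      exact hsr
    rw [contFrac, cfVal_cons, ih _ (Nat.mod_lt _ r.succ_pos) r.succ_pos hmod, Nat.div_add_mod']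

theorem IsContFrac.cfVal_eq {l : List ℕ} {s r : ℕ} (h : IsContFrac l s r) :
    cfVal (1, 0) l = (s, r) := by
  obtain ⟨hs, hsr, rfl | ⟨l', a, rfl, h⟩⟩ := h
  · exact cfVal_contFrac hs hsr
  · rw [← cfVal_contFrac hs hsr, h, cfVal_append, cfVal_append]
    simp

/-! ### Iterating the Burge recurrence -/

section ConsSigma

variable {α : Type*} {L : Finset α} {T : α → Finset (List α)}

/-- The lists `a :: l` with `a ∈ L` and `l ∈ T a`, used to enumerate sequences of partitions whose
bounds depend on the earlier members. -/
def consSigma (L : Finset α) (T : α → Finset (List α)) : Finset (List α) :=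
  (L.sigma T).map ⟨fun x => x.1 :: x.2, by
    rintro ⟨a, l⟩ ⟨b, l'⟩ h
    obtain ⟨rfl, rfl⟩ := List.cons.inj h
    rfl⟩

theorem cons_mem_consSigma {a : α} {l : List α} : a :: l ∈ consSigma L T ↔ a ∈ L ∧ l ∈ T a := by
  simp only [consSigma, Finset.mem_map, Finset.mem_sigma]
  constructor
  · rintro ⟨⟨b, l'⟩, hmem, h⟩
    obtain ⟨rfl, rfl⟩ := List.cons.inj h
    exact hmem
  · exact fun hmem => ⟨⟨a, l⟩, hmem, rfl⟩

theorem nil_notMem_consSigma : [] ∉ consSigma L T := by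
  simp [consSigma]

theorem sum_consSigma {A : Type*} [AddCommMonoid A] (L : Finset α) (T : α → Finset (List α))
    (F : List α → A) : ∑ l ∈ consSigma L T, F l = ∑ a ∈ L, ∑ l ∈ T a, F (a :: l) := by
  rw [consSigma, Finset.sum_map, Finset.sum_sigma]
  rfl

theorem sum_ite_singleton_empty {ι A : Type*} [AddCommMonoid A] (P : Prop) [Decidable P] (i : ι)
    (F : ι → A) : ∑ j ∈ if P then {i} else ∅, F j = if P then F i else 0 := by
  split_ifs <;> simp

end ConsSigma

/-- The partitions with `f` parts, in decreasing order, all at most `N` and of weight at most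
`M`. -/
def level : ℕ → ℕ → ℕ → Finset (List ℕ)
  | 0, _, _ => {[]}
  | f + 1, N, M => consSigma (Finset.range (min N M + 1)) fun n => level f n (M - n)

/-- The weight picked up along the parts of a partition by iterating a recurrence of Burge type
with exponents `e n`. -/
noncomputable def levelWt {A : Type*} [CommSemiring A] (q : A) (e : ℕ → ℕ) : ℕ → ℕ → List ℕ → A
  | _, _, [] => 1
  | N, M, n :: l => q ^ e n * boxGen q (N - n) (2 * M) * levelWt q e n (M - n) l

theorem eq_sum_level {A : Type*} [CommSemiring A] {q : A} {e : ℕ → ℕ} {T : ℕ → ℕ → ℕ → A}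
    (hT : ∀ j N M, T (j + 1) N M = ∑ n ∈ Finset.range (min N M + 1),
      q ^ e n * boxGen q (N - n) (2 * M) * T j n (M - n)) (f N M : ℕ) :
    T f N M = ∑ l ∈ level f N M, levelWt q e N M l * T 0 (l.getLastD N) (M - l.sum) := by
  induction f generalizing N M with
  | zero => simp [level, levelWt]
  | succ f ih =>
    rw [hT, level, sum_consSigma]
    refine Finset.sum_congr rfl fun n _ => ?_
    rw [ih, Finset.mul_sum]
    refine Finset.sum_congr rfl fun l _ => ?_
    rw [levelWt, List.getLastD_cons, List.sum_cons, Nat.sub_sub, ← mul_assoc]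

section Iterate

variable {A : Type*} [CommRing A] [IsDomain A] {q : A}

theorem squareGen_iterate (hq : q ≠ 0) {a b α β : ℕ} (hK : 0 < a + b) (hκ : 0 < α + β)
    (f N M : ℕ) :
    squareGen q N M a b (f * a + α) (f * b + β) = ∑ l ∈ level f N M,
      levelWt q (· ^ 2) N M l * squareGen q (l.getLastD N) (M - l.sum) a b α β := by
  have h := eq_sum_level (e := (· ^ 2))
    (T := fun j N M => squareGen q N M a b (j * a + α) (j * b + β)) (fun j N M => by
      rw [add_one_mul, add_one_mul, add_right_comm, add_right_comm (j * b)]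
      exact squareGen_burge hq hK (by omega) N M) f N M
  simpa only [zero_mul, zero_add] using h

theorem reducedGen_iterate (hq : q ≠ 0) {K κ : ℕ} (hK : 0 < K) (hκ : 0 < κ) (f N M : ℕ) :
    reducedGen q N M K (f * K + κ) = ∑ l ∈ level f N M,
      levelWt q (fun n => n * (n - 1)) N M l *
        reducedGen q (l.getLastD N) (M - l.sum) K κ := by
  have h := eq_sum_level (e := fun n => n * (n - 1))
    (T := fun j N M => reducedGen q N M K (j * K + κ)) (fun j N M => by
      rw [add_one_mul, add_right_comm]
      exact reducedGen_burge hq hK (by omega) N M) f N M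
  simpa only [zero_mul, zero_add] using h

end Iterate

/-- The sequences `n^{(u+1)}, …, n^{(x)}` of partitions with `(n_{u+1,0}, w_{u+1}) = (N, M)`, whose
numbers of parts form an initial segment of the given list. -/
def upper : List ℕ → ℕ → ℕ → Finset (List (List ℕ))
  | [], _, _ => ∅
  | g :: gs, N, M => consSigma (level g N M) fun l =>
      if l.getLastD N = 0 ∨ gs = [] then (if M - l.sum = 0 then {[]} else ∅)
      else upper gs (M - l.sum + 1) (l.getLastD N - 1)

/-- The factor of the summand contributed by `n^{(u+1)}, …, n^{(x)}`. -/
noncomputable def upperWt {A : Type*} [CommSemiring A] (q : A) : ℕ → ℕ → List (List ℕ) → A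
  | _, _, [] => 1
  | N, M, l :: ν => levelWt q (fun n => n * (n - 1)) N M l *
      upperWt q (M - l.sum + 1) (l.getLastD N - 1) ν

/-- The sequences `n^{(1)}, …, n^{(x)}` of partitions with `(n_{1,0}, w_1) = (N, M)`, where the
first `u` numbers of parts are prescribed by the second list and the later ones by `gs`. -/
def lower (gs : List ℕ) : List ℕ → ℕ → ℕ → Finset (List (List ℕ))
  | [], _, _ => ∅
  | f :: fs, N, M => consSigma (level f N M) fun l =>
      if fs = [] then
        if M - l.sum = 0 then (if l.getLastD N = 0 then {[]} else ∅)
        else upper gs (l.getLastD N + 1) (M - l.sum - 1)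
      else lower gs fs (M - l.sum) (l.getLastD N)

/-- The summand, with the Gaussian for `k = i = 1` included. -/
noncomputable def lowerWt {A : Type*} [CommSemiring A] (q : A) :
    List ℕ → ℕ → ℕ → List (List ℕ) → A
  | [], _, _, _ => 1
  | _, _, _, [] => 1
  | _ :: fs, N, M, l :: ν => levelWt q (· ^ 2) N M l *
      if fs = [] then q ^ l.getLastD N * upperWt q (l.getLastD N + 1) (M - l.sum - 1) ν
      else lowerWt q fs (M - l.sum) (l.getLastD N) ν

section Fermionic

variable {A : Type*} [CommRing A] [IsDomain A] {q : A}

theorem reducedGen_eq_sum_upper (hq : q ≠ 0) {gs : List ℕ} (hgs : gs ≠ []) (N M : ℕ) :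
    reducedGen q N M (cfVal (1, 2) gs).2 (cfVal (1, 2) gs).1 =
      ∑ ν ∈ upper gs N M, upperWt q N M ν := by
  induction gs generalizing N M with
  | nil => exact absurd rfl hgs
  | cons g gs ih =>
    obtain ⟨hpos, hpos'⟩ := cfVal_pos (v := (1, 2)) one_pos two_pos gs
    rw [cfVal_cons, reducedGen_iterate hq hpos hpos', upper, sum_consSigma]
    refine Finset.sum_congr rfl fun l _ => ?_
    simp only [upperWt, ← Finset.mul_sum]
    congr 1
    by_cases hlast : l.getLastD N = 0
    · rw [if_pos (Or.inl hlast), sum_ite_singleton_empty, hlast, reducedGen_zero_left, upperWt]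
    by_cases hnil : gs = []
    · rw [if_pos (Or.inr hnil), sum_ite_singleton_empty, hnil, cfVal_nil, reducedGen_one_two hq,
        upperWt]
    · obtain ⟨m, hm⟩ := Nat.exists_eq_succ_of_ne_zero hlast
      rw [if_neg (not_or.2 ⟨hlast, hnil⟩), hm, reducedGen_transpose hq, ih hnil,
        Nat.succ_sub_one]

theorem squareGen_one_zero_eq_sum_upper (hq : q ≠ 0) {gs : List ℕ} (hgs : gs ≠ []) {K κ : ℕ}
    (hv : cfVal (1, 2) gs = (κ, K)) (hκ : 0 < κ) (N M : ℕ) :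
    squareGen q N M 1 (K - 1) 0 κ =
      ∑ ν ∈ (if M = 0 then (if N = 0 then {[]} else ∅) else upper gs (N + 1) (M - 1)),
        q ^ N * upperWt q (N + 1) (M - 1) ν := by
  cases M with
  | zero =>
    rw [squareGen_one_zero_zero_right q _ _ hκ, if_pos rfl, sum_ite_singleton_empty, upperWt]
    split_ifs with hN <;> simp [hN]
  | succ M =>
    have hsum := reducedGen_eq_sum_upper hq hgs (N + 1) M
    obtain ⟨k, rfl⟩ := Nat.exists_eq_succ_of_ne_zero hκ.ne'
    rw [hv, reducedGen_succ] at hsum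
    rw [squareGen_one_zero hq, if_neg M.succ_ne_zero, ← Finset.mul_sum, Nat.add_sub_cancel, ← hsum,
      Nat.succ_sub_one]

theorem squareGen_eq_sum_lower (hq : q ≠ 0) {gs fs : List ℕ} (hgs : gs ≠ []) (hfs : fs ≠ [])
    {K κ : ℕ} (hv : cfVal (1, 2) gs = (κ, K)) (N M : ℕ) :
    squareGen q N M (cfVal (1, 0) fs).2 (cfVal (K - 1, κ) fs).2
      (cfVal (1, 0) fs).1 (cfVal (K - 1, κ) fs).1 =
      ∑ ν ∈ lower gs fs N M, lowerWt q fs N M ν := by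
  have hκ : 0 < κ := by
    simpa only [hv] using (cfVal_pos (v := (1, 2)) one_pos two_pos gs).1
  have hpos (l : List ℕ) : 0 < (cfVal (1, 0) l).1 + (cfVal (K - 1, κ) l).1 ∧
      0 < (cfVal (1, 0) l).2 + (cfVal (K - 1, κ) l).2 := by
    rw [← Prod.fst_add, ← Prod.snd_add, ← cfVal_add]
    exact cfVal_pos (by simp) (by simpa using hκ) l
  induction fs generalizing N M with
  | nil => exact absurd rfl hfs
  | cons f fs ih =>
    rw [cfVal_cons, cfVal_cons, squareGen_iterate hq (hpos fs).1 (hpos fs).2, lower,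
      sum_consSigma]
    refine Finset.sum_congr rfl fun l _ => ?_
    simp only [lowerWt, ← Finset.mul_sum]
    congr 1
    by_cases hnil : fs = []
    · simp only [if_pos hnil]
      rw [hnil, cfVal_nil, cfVal_nil, squareGen_one_zero_eq_sum_upper hq hgs hv hκ]
    · simp only [if_neg hnil]
      rw [squareGen_transpose hq (hpos fs).1 (hpos fs).2, ih hnil]

end Fermionic

/-! ### Admissible sequences, one partition at a time -/

theorem mem_level {f N M : ℕ} {l : List ℕ} : l ∈ level f N M ↔
    l.length = f ∧ (∀ i < f, l.getD i 0 ≤ (N :: l).getD i 0) ∧ l.sum ≤ M := by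
  induction f generalizing N M l with
  | zero =>
    rw [level, Finset.mem_singleton]
    constructor
    · rintro rfl
      simp
    · exact fun h => List.length_eq_zero_iff.1 h.1
  | succ f ih =>
    cases l with
    | nil => simp [level, nil_notMem_consSigma]
    | cons n l =>
      rw [level, cons_mem_consSigma, ih, Finset.mem_range, List.length_cons, List.sum_cons,
        Nat.add_right_cancel_iff, Nat.forall_lt_succ_left]
      simp only [List.getD_cons_zero, List.getD_cons_succ]
      constructor
      · rintro ⟨hn, hlen, hanti, hsum⟩
        exact ⟨hlen, ⟨by omega, hanti⟩, by omega⟩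
      · rintro ⟨hlen, ⟨hn, hanti⟩, hsum⟩
        exact ⟨by omega, hlen, hanti, by omega⟩

theorem getD_length_sub_one {l : List ℕ} (h : l ≠ []) (N : ℕ) :
    l.getD (l.length - 1) 0 = l.getLastD N := by
  rw [List.getD_eq_getElem?_getD, ← List.getLast?_eq_getElem?, List.getLast?_eq_some_getLast h,
    Option.getD_some, List.getLastD_eq_getLast?, List.getLast?_eq_some_getLast h, Option.getD_some]

section Membership

variable {l : List ℕ} {ν : List (List ℕ)}

theorem nil_notMem_upper (gs : List ℕ) (N M : ℕ) : [] ∉ upper gs N M := by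
  cases gs with
  | nil => simp [upper]
  | cons g gs => exact nil_notMem_consSigma

theorem nil_notMem_lower (gs fs : List ℕ) (N M : ℕ) : [] ∉ lower gs fs N M := by
  cases fs with
  | nil => simp [lower]
  | cons f fs => exact nil_notMem_consSigma

theorem mem_ite_singleton_empty {α : Type*} (P : Prop) [Decidable P] (x y : α) :
    x ∈ (if P then {y} else ∅ : Finset α) ↔ x = y ∧ P := by
  split_ifs with h <;> simp [h]

theorem singleton_mem_upper_iff {g : ℕ} {gs : List ℕ} {N M : ℕ} : [l] ∈ upper (g :: gs) N M ↔
    l ∈ level g N M ∧ M - l.sum = 0 ∧ (l.getLastD N = 0 ∨ gs = []) := by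
  rw [upper, cons_mem_consSigma]
  refine and_congr_right fun _ => ?_
  by_cases h : l.getLastD N = 0 ∨ gs = []
  · rw [if_pos h, mem_ite_singleton_empty, eq_self, true_and, and_iff_left h]
  · rw [if_neg h]
    exact iff_of_false (nil_notMem_upper _ _ _) fun h' => h h'.2

theorem cons_mem_upper_iff {g : ℕ} {gs : List ℕ} {N M : ℕ} (hν : ν ≠ []) :
    l :: ν ∈ upper (g :: gs) N M ↔ l ∈ level g N M ∧ l.getLastD N ≠ 0 ∧
      ν ∈ upper gs (M - l.sum + 1) (l.getLastD N - 1) := by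
  rw [upper, cons_mem_consSigma]
  refine and_congr_right fun _ => ?_
  split_ifs with h <;> rcases gs with - | ⟨g', gs⟩ <;> simp_all [upper]

theorem singleton_mem_lower_iff {gs : List ℕ} {f N M : ℕ} : [l] ∈ lower gs [f] N M ↔
    l ∈ level f N M ∧ M - l.sum = 0 ∧ l.getLastD N = 0 := by
  rw [lower, cons_mem_consSigma, if_pos rfl]
  refine and_congr_right fun _ => ?_
  split_ifs with h <;> simp_all [nil_notMem_upper]

theorem cons_mem_lower_singleton_iff {gs : List ℕ} {f N M : ℕ} (hν : ν ≠ []) :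
    l :: ν ∈ lower gs [f] N M ↔ l ∈ level f N M ∧ M - l.sum ≠ 0 ∧
      ν ∈ upper gs (l.getLastD N + 1) (M - l.sum - 1) := by
  rw [lower, cons_mem_consSigma, if_pos rfl]
  refine and_congr_right fun _ => ?_
  split_ifs with h <;> simp_all

theorem cons_mem_lower_iff {gs fs : List ℕ} {f N M : ℕ} (hfs : fs ≠ []) :
    l :: ν ∈ lower gs (f :: fs) N M ↔
      l ∈ level f N M ∧ ν ∈ lower gs fs (M - l.sum) (l.getLastD N) := by
  rw [lower, cons_mem_consSigma, if_neg hfs]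

end Membership

section Admissible

variable (M₀ t : ℕ) (f : ℕ → ℕ) (u : ℕ) (ν : List (List ℕ))

/-- The pair `(n_{k,0}, w_k)` is `(N, M)`. For `k = 1`, where `n_{1,0} = ∞`, every `N ≥ M` is as
good as `∞`, since the parts of `n^{(1)}` are at most its weight. -/
structure HasBounds (k N M : ℕ) : Prop where
  one_le : 1 ≤ k
  w_eq : w ⊤ M₀ f u ν k = M
  top : k = 1 → f 1 ≠ 0 ∧ M ≤ N
  n_zero_eq : k ≠ 1 → n ⊤ M₀ f u ν k 0 = N

/-- The conditions of `IsAdmissible` that hold for each partition `n^{(k)}` separately. -/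
structure IsAdmissibleAt (k : ℕ) : Prop where
  length : (prt ν k).length = f k
  antitone : ∀ i, 1 ≤ i → i ≤ f k → n ⊤ M₀ f u ν k i ≤ n ⊤ M₀ f u ν k (i - 1)
  wt_le : ((prt ν k).sum : ℕ∞) ≤ w ⊤ M₀ f u ν k

/-- The conditions of `IsAdmissible` that concern the partitions `n^{(j)}` with `j ≥ k`; the
inductive form of admissibility. -/
structure IsAdmissibleFrom (k : ℕ) : Prop where
  le : k ≤ ν.length
  le_length : u ≤ ν.length
  length_le : ν.length ≤ t + 1
  isAdmissibleAt : ∀ j, k ≤ j → j ≤ ν.length → IsAdmissibleAt M₀ f u ν j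
  wt_last : ((prt ν ν.length).sum : ℕ∞) = w ⊤ M₀ f u ν ν.length
  wt_u : k ≤ u → u < ν.length → ((prt ν u).sum : ℕ∞) < w ⊤ M₀ f u ν u
  pos : ∀ j, k ≤ j → u < j → j < ν.length → 0 < n ⊤ M₀ f u ν j (f j)
  zero : ν.length < t + 1 → n ⊤ M₀ f u ν ν.length (f ν.length) = 0

variable {M₀ t f u ν}

theorem isAdmissible_iff (hu : 1 ≤ u) :
    IsAdmissible ⊤ M₀ t f u ν ↔ IsAdmissibleFrom M₀ t f u ν 1 := by
  constructor
  · intro h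
    exact ⟨hu.trans h.le_length, h.le_length, h.length_le,
      fun j hj hj' => ⟨h.length_prt j hj hj', fun i => h.antitone j i hj hj', h.wt_le j hj hj'⟩,
      h.wt_last, fun _ => h.wt_u, fun j _ => h.pos j, h.zero⟩
  · intro h
    exact ⟨h.le_length, h.length_le, fun j hj hj' => (h.isAdmissibleAt j hj hj').length,
      fun j i hj hj' => (h.isAdmissibleAt j hj hj').antitone i,
      fun j hj hj' => (h.isAdmissibleAt j hj hj').wt_le,
      h.wt_last, h.wt_u hu, fun j hj => h.pos j (by omega) hj, h.zero⟩

theorem isAdmissibleFrom_iff_of_eq {k : ℕ} (hk : k = ν.length) :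
    IsAdmissibleFrom M₀ t f u ν k ↔ IsAdmissibleAt M₀ f u ν k ∧
      ((prt ν k).sum : ℕ∞) = w ⊤ M₀ f u ν k ∧ u ≤ k ∧ k ≤ t + 1 ∧
        (k < t + 1 → n ⊤ M₀ f u ν k (f k) = 0) := by
  subst hk
  constructor
  · exact fun h => ⟨h.isAdmissibleAt _ le_rfl le_rfl, h.wt_last, h.le_length, h.length_le, h.zero⟩
  · rintro ⟨hat, hsum, hu, ht, hzero⟩
    exact ⟨le_rfl, hu, ht, fun j hj hj' => le_antisymm hj hj' ▸ hat, hsum, fun _ _ => by omega,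
      fun j _ _ _ => by omega, hzero⟩

theorem isAdmissibleFrom_iff_of_lt {k : ℕ} (hk : k < ν.length) :
    IsAdmissibleFrom M₀ t f u ν k ↔
      IsAdmissibleAt M₀ f u ν k ∧ (k = u → ((prt ν u).sum : ℕ∞) < w ⊤ M₀ f u ν u) ∧
        (u < k → 0 < n ⊤ M₀ f u ν k (f k)) ∧ IsAdmissibleFrom M₀ t f u ν (k + 1) := by
  constructor
  · intro h
    exact ⟨h.isAdmissibleAt k le_rfl h.le, fun hku => h.wt_u hku.le (by omega),
      fun hu => h.pos k le_rfl hu hk, hk, h.le_length, h.length_le,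
      fun j hj => h.isAdmissibleAt j (by omega), h.wt_last, fun hj => h.wt_u (by omega),
      fun j hj => h.pos j (by omega), h.zero⟩
  · rintro ⟨hat, hwt, hpos, h⟩
    refine ⟨hk.le, h.le_length, h.length_le, fun j hj hj' => ?_, h.wt_last, fun hu hu' => ?_,
      fun j hj hj' hj'' => ?_, h.zero⟩
    · rcases Nat.eq_or_lt_of_le hj with rfl | hj
      · exact hat
      · exact h.isAdmissibleAt j hj hj'
    · rcases Nat.eq_or_lt_of_le hu with rfl | hu
      · exact hwt rfl
      · exact h.wt_u hu hu'
    · rcases Nat.eq_or_lt_of_le hj with rfl | hj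
      · exact hpos hj'
      · exact h.pos j hj hj' hj''

theorem n_succ (k i : ℕ) : n ⊤ M₀ f u ν k (i + 1) = ((prt ν k).getD i 0 : ℕ) := rfl

namespace HasBounds

variable {k N M : ℕ}

theorem n_eq (h : HasBounds M₀ f u ν k N M) {i : ℕ} (hi : i ≠ 0 ∨ k ≠ 1) :
    n ⊤ M₀ f u ν k i = ((N :: prt ν k).getD i 0 : ℕ) := by
  cases i with
  | zero => exact h.n_zero_eq (by omega)
  | succ i => rfl

theorem sum_le_w_iff (h : HasBounds M₀ f u ν k N M) :
    ((prt ν k).sum : ℕ∞) ≤ w ⊤ M₀ f u ν k ↔ (prt ν k).sum ≤ M := by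
  rw [h.w_eq, Nat.cast_le]

theorem mem_level_iff (h : HasBounds M₀ f u ν k N M) :
    prt ν k ∈ level (f k) N M ↔ IsAdmissibleAt M₀ f u ν k := by
  rw [mem_level]
  constructor
  · rintro ⟨hlen, hanti, hsum⟩
    refine ⟨hlen, fun i hi hi' => ?_, h.sum_le_w_iff.2 hsum⟩
    obtain ⟨i, rfl⟩ := Nat.exists_eq_add_of_le' hi
    rw [Nat.add_sub_cancel]
    by_cases hik : i ≠ 0 ∨ k ≠ 1
    · rw [h.n_eq hik, n_succ, Nat.cast_le]
      exact hanti i hi'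
    · push Not at hik
      obtain ⟨rfl, rfl⟩ := hik
      exact le_top
  · rintro ⟨hlen, hanti, hsum⟩
    have hsum' := h.sum_le_w_iff.1 hsum
    refine ⟨hlen, fun i hi => ?_, hsum'⟩
    by_cases hik : i ≠ 0 ∨ k ≠ 1
    · have hle := hanti (i + 1) (by omega) hi
      rwa [Nat.add_sub_cancel, h.n_eq hik, n_succ, Nat.cast_le] at hle
    · push Not at hik
      obtain ⟨rfl, rfl⟩ := hik
      refine le_trans ?_ (hsum'.trans (h.top rfl).2)
      cases prt ν 1 <;> simp

theorem n_last (h : HasBounds M₀ f u ν k N M) (hlen : (prt ν k).length = f k) :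
    n ⊤ M₀ f u ν k (f k) = ((prt ν k).getLastD N : ℕ) := by
  by_cases hnil : prt ν k = []
  · have hf : f k = 0 := by rw [← hlen, hnil, List.length_nil]
    rw [hf, h.n_eq (Or.inr fun hk => (h.top hk).1 (hk ▸ hf)), hnil]
    rfl
  · obtain ⟨i, hi⟩ := Nat.exists_eq_succ_of_ne_zero (List.length_pos_of_ne_nil hnil).ne'
    rw [← getD_length_sub_one hnil, ← hlen, hi]
    rfl

theorem n_last_eq_zero_iff (h : HasBounds M₀ f u ν k N M) (hat : IsAdmissibleAt M₀ f u ν k) :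
    n ⊤ M₀ f u ν k (f k) = 0 ↔ (prt ν k).getLastD N = 0 := by
  rw [h.n_last hat.length, Nat.cast_eq_zero]

theorem sum_eq_w_iff (h : HasBounds M₀ f u ν k N M) (hat : IsAdmissibleAt M₀ f u ν k) :
    ((prt ν k).sum : ℕ∞) = w ⊤ M₀ f u ν k ↔ M - (prt ν k).sum = 0 := by
  have hle := h.sum_le_w_iff.1 hat.wt_le
  rw [h.w_eq, Nat.cast_inj]
  omega

theorem bounds_add_one (h : HasBounds M₀ f u ν k N M) (hat : IsAdmissibleAt M₀ f u ν k) :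
    bounds ⊤ M₀ f u ν (k + 1) =
      if k + 1 ≤ u then ((M : ℕ∞) - (prt ν k).sum, ((prt ν k).getLastD N : ℕ∞))
      else if k + 1 = u + 1 then (((prt ν k).getLastD N : ℕ∞) + 1, (M : ℕ∞) - 1 - (prt ν k).sum)
      else ((M : ℕ∞) + 1 - (prt ν k).sum, ((prt ν k).getLastD N : ℕ∞) - 1) := by
  rw [← h.w_eq, ← h.n_last hat.length]
  obtain ⟨k, rfl⟩ := Nat.exists_eq_add_of_le' h.one_le
  rfl

theorem add_one_of_bounds (hk : 1 ≤ k) (h : bounds ⊤ M₀ f u ν (k + 1) = (↑N, ↑M)) :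
    HasBounds M₀ f u ν (k + 1) N M :=
  ⟨by omega, congrArg Prod.snd h, fun _ => by omega, fun _ => congrArg Prod.fst h⟩

theorem add_one_of_lt (h : HasBounds M₀ f u ν k N M) (hat : IsAdmissibleAt M₀ f u ν k)
    (hk : k < u) :
    HasBounds M₀ f u ν (k + 1) (M - (prt ν k).sum) ((prt ν k).getLastD N) := by
  refine add_one_of_bounds h.one_le ?_
  rw [h.bounds_add_one hat, if_pos (by omega), ENat.natCast_sub]

theorem add_one_of_eq (h : HasBounds M₀ f u ν u N M) (hat : IsAdmissibleAt M₀ f u ν u) :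
    HasBounds M₀ f u ν (u + 1) ((prt ν u).getLastD N + 1) (M - (prt ν u).sum - 1) := by
  refine add_one_of_bounds h.one_le ?_
  rw [h.bounds_add_one hat, if_neg (by omega), if_pos rfl, Nat.sub_right_comm]
  push_cast
  rfl

theorem add_one_of_gt (h : HasBounds M₀ f u ν k N M) (hat : IsAdmissibleAt M₀ f u ν k)
    (hk : u < k) :
    HasBounds M₀ f u ν (k + 1) (M - (prt ν k).sum + 1) ((prt ν k).getLastD N - 1) := by
  refine add_one_of_bounds h.one_le ?_
  rw [h.bounds_add_one hat, if_neg (by omega), if_neg (by omega),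
    ← Nat.sub_add_comm (h.sum_le_w_iff.1 hat.wt_le)]
  push_cast
  rfl

end HasBounds

theorem drop_eq_cons {k : ℕ} (hk : 1 ≤ k) (h : k ≤ ν.length) :
    ν.drop (k - 1) = prt ν k :: ν.drop k := by
  have hlt : k - 1 < ν.length := by omega
  rw [List.drop_eq_getElem_cons hlt, prt, List.getD_eq_getElem _ _ hlt, Nat.sub_add_cancel hk]

theorem map_range'_sub (f : ℕ → ℕ) {k m : ℕ} (h : k < m) :
    (List.range' k (m - k)).map f = f k :: (List.range' (k + 1) (m - (k + 1))).map f := by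
  rw [show m - k = m - (k + 1) + 1 by omega, List.range'_succ, List.map_cons]

theorem mem_upper_iff {k N M : ℕ} (hk : u < k) (h : HasBounds M₀ f u ν k N M) :
    ν.drop (k - 1) ∈ upper ((List.range' k (t + 2 - k)).map f) N M ↔
      IsAdmissibleFrom M₀ t f u ν k := by
  rcases lt_or_ge ν.length k with hlen | hlen
  · rw [List.drop_eq_nil_of_le (by omega)]
    exact iff_of_false (nil_notMem_upper _ _ _) fun h' => hlen.not_ge h'.le
  obtain ⟨m, hm⟩ := Nat.exists_eq_add_of_le hlen
  induction m generalizing k N M with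
  | zero =>
    by_cases hkt : k < t + 2
    · rw [drop_eq_cons h.one_le hlen, List.drop_eq_nil_of_le (by omega), map_range'_sub f hkt,
        singleton_mem_upper_iff, h.mem_level_iff, isAdmissibleFrom_iff_of_eq (by omega)]
      refine and_congr_right fun hat => ?_
      rw [h.sum_eq_w_iff hat, h.n_last_eq_zero_iff hat, List.map_eq_nil_iff,
        List.range'_eq_nil_iff]
      omega
    · rw [show t + 2 - k = 0 by omega]
      exact iff_of_false (by simp [upper]) fun h' => by have := h'.length_le; omega
  | succ m ih =>
    by_cases hkt : k < t + 2
    · rw [drop_eq_cons h.one_le hlen, map_range'_sub f hkt,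
        cons_mem_upper_iff (by rw [ne_eq, List.drop_eq_nil_iff]; omega), h.mem_level_iff,
        isAdmissibleFrom_iff_of_lt (by omega)]
      refine and_congr_right fun hat => ?_
      have ih' := ih (by omega) (h.add_one_of_gt hat hk) (by omega) (by omega)
      rw [Nat.add_sub_cancel] at ih'
      rw [ih', pos_iff_ne_zero, ne_eq, ne_eq, h.n_last_eq_zero_iff hat]
      simp [hk, hk.ne']
    · rw [show t + 2 - k = 0 by omega]
      exact iff_of_false (by simp [upper]) fun h' => by have := h'.length_le; omega

theorem mem_lower_last_iff {N M : ℕ} (hut : u ≤ t) (h : HasBounds M₀ f u ν u N M) :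
    ν.drop (u - 1) ∈ lower ((List.range' (u + 1) (t + 2 - (u + 1))).map f) [f u] N M ↔
      IsAdmissibleFrom M₀ t f u ν u := by
  rcases lt_trichotomy ν.length u with hlen | hlen | hlen
  · rw [List.drop_eq_nil_of_le (by omega)]
    exact iff_of_false (nil_notMem_lower _ _ _ _) fun h' => hlen.not_ge h'.le
  · rw [drop_eq_cons h.one_le hlen.ge, List.drop_eq_nil_of_le hlen.le, singleton_mem_lower_iff,
      h.mem_level_iff, isAdmissibleFrom_iff_of_eq hlen.symm]
    refine and_congr_right fun hat => ?_
    rw [h.sum_eq_w_iff hat, h.n_last_eq_zero_iff hat]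
    omega
  · rw [drop_eq_cons h.one_le hlen.le,
      cons_mem_lower_singleton_iff (by rw [ne_eq, List.drop_eq_nil_iff]; omega), h.mem_level_iff,
      isAdmissibleFrom_iff_of_lt hlen]
    refine and_congr_right fun hat => ?_
    have hupper := mem_upper_iff (t := t) u.lt_add_one (h.add_one_of_eq hat)
    rw [Nat.add_sub_cancel] at hupper
    rw [hupper, lt_iff_le_and_ne, and_iff_right hat.wt_le, ne_eq, ne_eq, h.sum_eq_w_iff hat]
    simp

theorem mem_lower_iff {k N M : ℕ} (hk : k ≤ u) (hut : u ≤ t) (h : HasBounds M₀ f u ν k N M) :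
    ν.drop (k - 1) ∈ lower ((List.range' (u + 1) (t + 2 - (u + 1))).map f)
      ((List.range' k (u + 1 - k)).map f) N M ↔ IsAdmissibleFrom M₀ t f u ν k := by
  obtain ⟨j, hj⟩ := Nat.exists_eq_add_of_le hk
  induction j generalizing k N M with
  | zero =>
    obtain rfl : u = k := hj
    rw [map_range'_sub f u.lt_add_one, Nat.sub_self, List.range'_zero, List.map_nil,
      mem_lower_last_iff hut h]
  | succ j ih =>
    rcases lt_or_ge k ν.length with hlen | hlen
    · rw [drop_eq_cons h.one_le hlen.le, map_range'_sub f (k := k) (by omega),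
        cons_mem_lower_iff (by simp; omega), h.mem_level_iff, isAdmissibleFrom_iff_of_lt hlen]
      refine and_congr_right fun hat => ?_
      have ih' := ih (by omega) (h.add_one_of_lt hat (by omega)) (by omega)
      rw [Nat.add_sub_cancel] at ih'
      rw [ih', ← and_assoc]
      exact (and_iff_right ⟨fun _ => by omega, fun _ => by omega⟩).symm
    · have hnot : ¬ IsAdmissibleFrom M₀ t f u ν k := fun h' => by
        have := h'.le_length
        omega
      refine iff_of_false ?_ hnot
      rcases hlen.eq_or_lt with hlen | hlen
      · rw [drop_eq_cons h.one_le hlen.ge, List.drop_eq_nil_of_le hlen.le,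
          map_range'_sub f (k := k) (by omega), cons_mem_lower_iff (by simp; omega)]
        exact fun h' => nil_notMem_lower _ _ _ _ h'.2
      · rw [List.drop_eq_nil_of_le (by omega)]
        exact nil_notMem_lower _ _ _ _

end Admissible

/-! ### The summands of the fermionic sum -/

theorem qFact_mul_qFactInv (n : ℕ) : qFact n * qFactInv n = 1 := by
  refine PowerSeries.mul_invOfUnit _ _ ?_
  rw [qFact, map_prod, Units.val_one]
  refine Finset.prod_eq_one fun j hj => ?_
  have hj0 : j ≠ 0 := (Nat.succ_le_iff.1 (Finset.mem_Icc.1 hj).1).ne'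
  simp [hj0]

theorem boxGen_mul_qFact_mul_qFact (k m : ℕ) :
    boxGen PowerSeries.X k m * qFact m * qFact k = qFact (k + m) := by
  rw [qFact, boxGen_mul_prod_one_sub_pow, mul_comm, qFact, qFact,
    ← Finset.Ico_add_one_right_eq_Icc, ← Finset.Ico_add_one_right_eq_Icc,
    ← Finset.Ico_add_one_right_eq_Icc, ← Finset.prod_Ico_consecutive _ (le_add_self : 1 ≤ k + 1)
      (by omega : k + 1 ≤ k + m + 1), Finset.prod_Ico_add (fun j => 1 - PowerSeries.X ^ j),
    add_comm k 1, add_comm (m + 1) k, add_assoc]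

theorem gauss_eq_boxGen {P N : ℕ} (h : N ≤ P) : gauss P N = boxGen PowerSeries.X N (P - N) := by
  have hmul := boxGen_mul_qFact_mul_qFact N (P - N)
  rw [Nat.add_sub_cancel' h] at hmul
  rw [gauss, if_pos h, ← hmul]
  linear_combination boxGen PowerSeries.X N (P - N) * qFact (P - N) * qFactInv (P - N) *
    qFact_mul_qFactInv N + boxGen PowerSeries.X N (P - N) * qFact_mul_qFactInv (P - N)

@[to_additive]
theorem prod_Icc_eq_prod_range {A : Type*} [CommMonoid A] (F : ℕ → A) (m : ℕ) :
    ∏ i ∈ Finset.Icc 1 m, F i = ∏ i ∈ Finset.range m, F (i + 1) := by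
  rw [← Finset.Ico_add_one_right_eq_Icc, Finset.prod_Ico_eq_prod_range, Nat.add_sub_cancel]
  simp only [add_comm 1]

section LevelFactor

variable {A : Type*} [CommSemiring A] (q : A)

/-- The Gaussian polynomial contributed by the `i`-th part of a partition `l` bounded by `N` with
prescribed maximal weight `M`. -/
noncomputable def levelFactor (N M : ℕ) (l : List ℕ) (i : ℕ) : A :=
  boxGen q ((N :: l).getD (i - 1) 0 - l.getD (i - 1) 0)
    (2 * (M - ∑ j ∈ Finset.Icc 1 (i - 1), l.getD (j - 1) 0))

theorem levelFactor_cons_one (N M a : ℕ) (l : List ℕ) :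
    levelFactor q N M (a :: l) 1 = boxGen q (N - a) (2 * M) := by
  simp [levelFactor]

theorem levelFactor_cons_add_two (N M a : ℕ) (l : List ℕ) (i : ℕ) :
    levelFactor q N M (a :: l) (i + 1 + 1) = levelFactor q a (M - a) l (i + 1) := by
  simp only [levelFactor, Nat.add_sub_cancel, List.getD_cons_succ, sum_Icc_eq_sum_range,
    Finset.sum_range_succ', List.getD_cons_zero, Nat.sub_sub, add_comm a]

theorem levelWt_eq (e : ℕ → ℕ) (N M : ℕ) (l : List ℕ) : levelWt q e N M l =
    q ^ (∑ i ∈ Finset.Icc 1 l.length, e (l.getD (i - 1) 0)) *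
      ∏ i ∈ Finset.Icc 1 l.length, levelFactor q N M l i := by
  simp only [prod_Icc_eq_prod_range, sum_Icc_eq_sum_range, Nat.add_sub_cancel]
  induction l generalizing N M with
  | nil => simp [levelWt]
  | cons a l ih =>
    rw [levelWt, ih, List.length_cons, Finset.sum_range_succ', Finset.prod_range_succ']
    simp only [List.getD_cons_succ, List.getD_cons_zero, zero_add, levelFactor_cons_one,
      levelFactor_cons_add_two, pow_add]
    ring

end LevelFactor

theorem sum_Icc_getD_le (l : List ℕ) (m : ℕ) :
    ∑ i ∈ Finset.Icc 1 m, l.getD (i - 1) 0 ≤ l.sum := by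
  simp only [sum_Icc_eq_sum_range, Nat.add_sub_cancel]
  induction l generalizing m with
  | nil => simp
  | cons a l ih =>
    cases m with
    | zero => simp
    | succ m =>
      rw [Finset.sum_range_succ', List.sum_cons, List.getD_cons_zero, add_comm]
      simpa only [List.getD_cons_succ] using Nat.add_le_add_left (ih m) a

section Summand

variable {M₀ t : ℕ} {f : ℕ → ℕ} {u : ℕ} {ν : List (List ℕ)}

/-- The contribution of the partition `n^{(k)}` to the summand for `ν`. -/
noncomputable def levelTerm (e : ℕ → ℕ) (M₀ : ℕ) (f : ℕ → ℕ) (u : ℕ) (ν : List (List ℕ)) (k : ℕ) :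
    ℤ⟦X⟧ :=
  PowerSeries.X ^ (∑ i ∈ Finset.Icc 1 (f k), e (part ν k i)) *
    ∏ i ∈ Finset.Icc (if k = 1 then 2 else 1) (f k), gaussFactor ⊤ M₀ f u ν k i

theorem HasBounds.gaussFactor_eq {k N M i : ℕ} (h : HasBounds M₀ f u ν k N M)
    (hat : IsAdmissibleAt M₀ f u ν k) (hi : i ∈ Finset.Icc (if k = 1 then 2 else 1) (f k)) :
    gaussFactor ⊤ M₀ f u ν k i = levelFactor PowerSeries.X N M (prt ν k) i := by
  obtain ⟨hle, hif⟩ := Finset.mem_Icc.1 hi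
  obtain ⟨i, rfl⟩ : ∃ j, i = j + 1 := Nat.exists_eq_add_of_le' (by split_ifs at hle <;> omega)
  obtain ⟨-, hanti, hsum⟩ := mem_level.1 (h.mem_level_iff.2 hat)
  have hpart := hanti i hif
  have hpartial := (sum_Icc_getD_le (prt ν k) (i + 1)).trans hsum
  rw [Finset.sum_Icc_succ_top (by omega), Nat.add_sub_cancel] at hpartial
  rw [gaussFactor, levelFactor, Nat.add_sub_cancel,
    h.n_eq (by split_ifs at hle <;> omega), h.w_eq, Finset.sum_Icc_succ_top (by omega)]
  simp only [part, Nat.add_sub_cancel, ENat.toNat_natCast]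
  rw [gauss_eq_boxGen (by omega)]
  congr 1
  omega

theorem HasBounds.levelWt_prt {k N M : ℕ} (h : HasBounds M₀ f u ν k N M)
    (hat : IsAdmissibleAt M₀ f u ν k) (e : ℕ → ℕ) :
    levelWt PowerSeries.X e N M (prt ν k) =
      (if k = 1 then boxGen PowerSeries.X (N - part ν 1 1) (2 * M) else 1) *
        levelTerm e M₀ f u ν k := by
  rw [levelWt_eq, hat.length, levelTerm, Finset.prod_congr rfl fun i => h.gaussFactor_eq hat]
  split_ifs with hk
  · subst hk
    have hone : levelFactor PowerSeries.X N M (prt ν 1) 1 =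
        (boxGen PowerSeries.X (N - part ν 1 1) (2 * M) : ℤ⟦X⟧) := by
      simp [levelFactor, part]
    rw [← Finset.mul_prod_Ioc_eq_prod_Icc (Nat.one_le_iff_ne_zero.2 (h.top rfl).1),
      ← Finset.Icc_add_one_left_eq_Ioc, hone, mul_left_comm]
    rfl
  · rw [one_mul]
    rfl

theorem upperWt_drop {k N M : ℕ} (hu : 1 ≤ u) (hk : u < k) (h : HasBounds M₀ f u ν k N M)
    (hν : IsAdmissibleFrom M₀ t f u ν k) : upperWt PowerSeries.X N M (ν.drop (k - 1)) =
      ∏ j ∈ Finset.Icc k ν.length, levelTerm (fun n => n * (n - 1)) M₀ f u ν j := by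
  obtain ⟨m, hm⟩ := Nat.exists_eq_add_of_le hν.le
  induction m generalizing k N M with
  | zero =>
    rw [drop_eq_cons h.one_le hν.le, List.drop_eq_nil_of_le (by omega), upperWt, upperWt,
      h.levelWt_prt (hν.isAdmissibleAt k le_rfl hν.le), if_neg (by omega), hm, add_zero,
      Finset.Icc_self, Finset.prod_singleton, one_mul, mul_one]
  | succ m ih =>
    obtain ⟨hat, -, -, hν'⟩ := (isAdmissibleFrom_iff_of_lt (by omega)).1 hν
    have ih' := ih (by omega) (h.add_one_of_gt hat hk) hν' (by omega)
    rw [Nat.add_sub_cancel] at ih'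
    rw [drop_eq_cons h.one_le hν.le, upperWt, ih', h.levelWt_prt hat, if_neg (by omega), one_mul,
      ← Finset.mul_prod_Ioc_eq_prod_Icc hν.le, ← Finset.Icc_add_one_left_eq_Ioc]

theorem lowerWt_drop_last {N M : ℕ} (hfu : f u ≠ 0) (h : HasBounds M₀ f u ν u N M)
    (hν : IsAdmissibleFrom M₀ t f u ν u) :
    lowerWt PowerSeries.X [f u] N M (ν.drop (u - 1)) =
      (if u = 1 then boxGen PowerSeries.X (N - part ν 1 1) (2 * M) else 1) *
      (PowerSeries.X ^ part ν u (f u) * levelTerm (fun n => n ^ 2) M₀ f u ν u *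
        ∏ j ∈ Finset.Icc (u + 1) ν.length, levelTerm (fun n => n * (n - 1)) M₀ f u ν j) := by
  have hat := hν.isAdmissibleAt u le_rfl hν.le
  have hlast : (prt ν u).getLastD N = part ν u (f u) := by
    rw [← getD_length_sub_one (List.ne_nil_of_length_pos (by rw [hat.length]; omega)), hat.length,
      part]
  have hupper : upperWt PowerSeries.X (part ν u (f u) + 1) (M - (prt ν u).sum - 1) (ν.drop u) =
      ∏ j ∈ Finset.Icc (u + 1) ν.length, levelTerm (fun n => n * (n - 1)) M₀ f u ν j := by
    rcases hν.le.eq_or_lt with hlen | hlen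
    · rw [List.drop_eq_nil_of_le hlen.ge, upperWt, Finset.Icc_eq_empty (by omega),
        Finset.prod_empty]
    · rw [← hlast]
      exact upperWt_drop h.one_le u.lt_add_one (h.add_one_of_eq hat)
        ((isAdmissibleFrom_iff_of_lt hlen).1 hν).2.2.2
  rw [drop_eq_cons h.one_le hν.le, lowerWt, h.levelWt_prt hat, if_pos rfl, hlast, hupper]
  ring

theorem lowerWt_drop {k N M : ℕ} (hk : k ≤ u) (hfu : f u ≠ 0) (h : HasBounds M₀ f u ν k N M)
    (hν : IsAdmissibleFrom M₀ t f u ν k) :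
    lowerWt PowerSeries.X ((List.range' k (u + 1 - k)).map f) N M (ν.drop (k - 1)) =
      (if k = 1 then boxGen PowerSeries.X (N - part ν 1 1) (2 * M) else 1) *
      (PowerSeries.X ^ part ν u (f u) *
        (∏ j ∈ Finset.Icc k u, levelTerm (fun n => n ^ 2) M₀ f u ν j) *
        ∏ j ∈ Finset.Icc (u + 1) ν.length, levelTerm (fun n => n * (n - 1)) M₀ f u ν j) := by
  obtain ⟨m, hm⟩ := Nat.exists_eq_add_of_le hk
  induction m generalizing k N M with
  | zero =>
    obtain rfl : u = k := hm
    rw [map_range'_sub f u.lt_add_one, Nat.sub_self, List.range'_zero, List.map_nil,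
      lowerWt_drop_last hfu h hν, Finset.Icc_self, Finset.prod_singleton]
  | succ m ih =>
    have hle := hν.le_length
    obtain ⟨hat, -, -, hν'⟩ := (isAdmissibleFrom_iff_of_lt (by omega)).1 hν
    have ih' := ih (by omega) (h.add_one_of_lt hat (by omega)) hν' (by omega)
    rw [Nat.add_sub_cancel, if_neg (by have := h.one_le; omega), one_mul] at ih'
    have hne : (List.range' (k + 1) (u + 1 - (k + 1))).map f ≠ [] := by
      rw [ne_eq, List.map_eq_nil_iff, List.range'_eq_nil_iff]
      omega
    rw [map_range'_sub f (by omega : k < u + 1), drop_eq_cons h.one_le hν.le, lowerWt,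
      h.levelWt_prt hat, if_neg hne, ih', ← Finset.mul_prod_Ioc_eq_prod_Icc hk,
      ← Finset.Icc_add_one_left_eq_Ioc]
    ring

theorem term_eq_mul_prod_levelTerm (hν : u ≤ ν.length) (d : ℕ) : term ⊤ M₀ f u d ν =
    PowerSeries.X ^ part ν u d * (∏ j ∈ Finset.Icc 1 u, levelTerm (fun n => n ^ 2) M₀ f u ν j) *
      ∏ j ∈ Finset.Icc (u + 1) ν.length, levelTerm (fun n => n * (n - 1)) M₀ f u ν j := by
  simp only [levelTerm, Finset.prod_mul_distrib, Finset.prod_pow_eq_pow_sum, term, qExponent,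
    pow_add]
  rw [← Finset.Ico_add_one_right_eq_Icc 1 ν.length,
    ← Finset.prod_Ico_consecutive _ (le_add_self : 1 ≤ u + 1) (by omega : u + 1 ≤ ν.length + 1),
    Finset.Ico_add_one_right_eq_Icc, Finset.Ico_add_one_right_eq_Icc]
  ring

theorem lowerWt_eq {N : ℕ} (hu : 1 ≤ u) (hfu : f u ≠ 0) (h : HasBounds M₀ f u ν 1 N M₀)
    (hν : IsAdmissibleFrom M₀ t f u ν 1) :
    lowerWt PowerSeries.X ((List.range' 1 u).map f) N M₀ ν =
      boxGen PowerSeries.X (N - part ν 1 1) (2 * M₀) * term ⊤ M₀ f u (f u) ν := by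
  rw [term_eq_mul_prod_levelTerm hν.le_length]
  simpa only [Nat.add_sub_cancel, Nat.sub_self, List.drop_zero, if_pos] using
    lowerWt_drop hu hfu h hν

end Summand

/-! ### The continued fractions of the theorem and the limit -/

theorem tendsto_boxGen (k m : ℕ) :
    Tendsto (fun N : ℕ => boxGen (PowerSeries.X : ℤ⟦X⟧) (N - k) m) atTop (𝓝 (qFactInv m)) := by
  have hpow (j : ℕ) : Tendsto (fun N : ℕ => (PowerSeries.X : ℤ⟦X⟧) ^ (N + j)) atTop (𝓝 0) :=
    (PowerSeries.WithPiTopology.isTopologicallyNilpotent_of_constantCoeff_zero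
      PowerSeries.constantCoeff_X).comp (tendsto_add_atTop_nat j)
  have hprod : Tendsto (fun N : ℕ => ∏ j ∈ Finset.Icc 1 m, (1 - (PowerSeries.X : ℤ⟦X⟧) ^ (N + j)))
      atTop (𝓝 1) := by
    simpa using tendsto_finsetProd (Finset.Icc 1 m) fun j _ => (hpow j).const_sub 1
  have hbox (N : ℕ) : boxGen (PowerSeries.X : ℤ⟦X⟧) N m =
      (∏ j ∈ Finset.Icc 1 m, (1 - PowerSeries.X ^ (N + j))) * qFactInv m := by
    rw [← boxGen_mul_prod_one_sub_pow, ← qFact, mul_assoc, qFact_mul_qFactInv, mul_one]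
  simp only [hbox]
  simpa only [one_mul, Function.comp_def] using
    (hprod.mul_const (qFactInv m)).comp (tendsto_sub_atTop_nat k)

theorem cfVal_tsub {v v' : ℕ × ℕ} (h : v' ≤ v) (l : List ℕ) :
    cfVal (v - v') l = cfVal v l - cfVal v' l := by
  rw [← tsub_add_cancel_of_le h, cfVal_add, add_tsub_cancel_right, add_tsub_cancel_right]

section FSeq

variable (c : ℕ → ℕ) {t u : ℕ}

theorem fSeq_self (u d : ℕ) : fSeq c u d u = d := by
  rw [fSeq, if_neg (lt_irrefl u), if_pos rfl]

theorem map_fSeq_lower (hu : 1 ≤ u) (d : ℕ) :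
    (List.range' 1 u).map (fSeq c u d) = (List.range' 1 (u - 1)).map c ++ [d] := by
  obtain ⟨m, rfl⟩ := Nat.exists_eq_add_of_le' hu
  rw [Nat.add_sub_cancel, List.range'_1_concat, List.map_append, List.map_singleton, add_comm 1 m,
    fSeq_self]
  refine congrArg (· ++ [d]) (List.map_congr_left fun k hk => ?_)
  rw [List.mem_range'_1] at hk
  rw [fSeq, if_pos (by omega)]

theorem map_fSeq_upper (hut : u ≤ t) (d : ℕ) :
    (List.range' (u + 1) (t + 1 - u)).map (fSeq c u d) =
      (c u - d) :: (List.range' (u + 1) (t - u)).map c := by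
  rw [show t + 1 - u = t - u + 1 by omega, List.range'_succ, List.map_cons,
    show fSeq c u d (u + 1) = c u - d by simp [fSeq], List.range'_eq_map_range,
    List.range'_eq_map_range, List.map_map, List.map_map]
  refine congrArg _ (List.map_congr_left fun k _ => ?_)
  rw [Function.comp_apply, Function.comp_apply, fSeq, if_neg (by omega), if_neg (by omega),
    if_neg (by omega), show u + 1 + 1 + k - 1 = u + 1 + k by omega]

theorem cfVal_last_add_two (ht : 1 ≤ t) :
    cfVal (1, 0) ((List.range' 1 (t - 1)).map c ++ [c t + 2]) =
      cfVal (1, 2) ((List.range' 1 t).map c) := by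
  obtain ⟨m, rfl⟩ := Nat.exists_eq_add_of_le' ht
  rw [Nat.add_sub_cancel, List.range'_1_concat, List.map_append, cfVal_append, cfVal_append,
    add_comm 1 m]
  simp

/-- Euclid's algorithm, interrupted after the `d`-th subtraction of its `u`-th stage. -/
theorem cfVal_split (hu : 1 ≤ u) (hut : u ≤ t) {d : ℕ} (hd : d ≤ c u) :
    cfVal (1, 2) ((List.range' 1 t).map c) =
      cfVal (cfVal (1, 2) ((List.range' (u + 1) (t + 1 - u)).map (fSeq c u d))).swap
        ((List.range' 1 u).map (fSeq c u d)) := by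
  have hrange : List.range' 1 t = List.range' 1 (u - 1) ++ u :: List.range' (u + 1) (t - u) := by
    rw [← List.range'_succ, show t = u - 1 + (t - u + 1) by omega, ← List.range'_append_1]
    congr 2 <;> omega
  obtain ⟨e, he⟩ := Nat.exists_eq_add_of_le hd
  rw [map_fSeq_lower c hu, map_fSeq_upper c hut, hrange, List.map_append, List.map_cons,
    cfVal_append, cfVal_append, he, Nat.add_sub_cancel_left]
  congr 1
  simp only [cfVal_cons, cfVal_nil, Prod.fst_swap, Prod.snd_swap, Prod.mk.injEq, and_true]
  ring

variable {c}

theorem fSeq_one_ne_zero {p p' d : ℕ} (hp : 0 < p) (hpp' : p < p')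
    (hc : IsContFrac ((List.range' 1 (t - 1)).map c ++ [c t + 2]) p' p) (hu : 1 ≤ u) (hut : u ≤ t)
    (hd : 1 ≤ d) : fSeq c u d 1 ≠ 0 := by
  rcases hu.eq_or_lt with rfl | hu
  · rw [fSeq_self]
    omega
  · rw [fSeq, if_pos hu]
    obtain ⟨-, -, hcf | ⟨l', a, hlast, -⟩⟩ := hc
    · obtain ⟨p, rfl⟩ := Nat.exists_eq_add_of_le' hp
      rw [contFrac, show t - 1 = t - 2 + 1 by omega, List.range'_succ, List.map_cons,
        List.cons_append] at hcf
      rw [← (List.cons.inj hcf).1]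
      exact (Nat.div_pos hpp'.le hp).ne'
    · simpa using congrArg List.getLast? hlast

end FSeq

/-- The sequences over which the fermionic sum runs, with `(n_{1,0}, w_1) = (N, M)`. -/
def fermionicIndex (f : ℕ → ℕ) (t u N M : ℕ) : Finset (List (List ℕ)) :=
  lower ((List.range' (u + 1) (t + 1 - u)).map f) ((List.range' 1 u).map f) N M

section FermionicIndex

variable {t u : ℕ}

theorem HasBounds.one {f : ℕ → ℕ} {N M : ℕ} (hf : f 1 ≠ 0) (hN : M ≤ N) (u : ℕ)
    (ν : List (List ℕ)) : HasBounds M f u ν 1 N M :=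
  ⟨le_rfl, rfl, fun _ => ⟨hf, hN⟩, fun h => absurd rfl h⟩

theorem mem_fermionicIndex {f : ℕ → ℕ} {N M : ℕ} {ν : List (List ℕ)} (hf : f 1 ≠ 0) (hu : 1 ≤ u)
    (hut : u ≤ t) (hN : M ≤ N) : ν ∈ fermionicIndex f t u N M ↔ IsAdmissible ⊤ M t f u ν := by
  rw [isAdmissible_iff hu, ← mem_lower_iff hu hut (HasBounds.one hf hN u ν), fermionicIndex,
    show t + 1 - u = t + 2 - (u + 1) by omega]
  rfl

variable {p p' d r s : ℕ} {c : ℕ → ℕ}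

theorem R_eq_sum_lowerWt (ht : 1 ≤ t)
    (hc : IsContFrac ((List.range' 1 (t - 1)).map c ++ [c t + 2]) p' p)
    (hu : 1 ≤ u) (hut : u ≤ t) (hdc : d ≤ c u)
    (hrs : IsContFrac ((List.range' 1 (u - 1)).map c ++ [d]) s r) (N M : ℕ) :
    R N M r (p - r) s (p' - s) = ∑ ν ∈ fermionicIndex (fSeq c u d) t u N M,
      lowerWt PowerSeries.X ((List.range' 1 u).map (fSeq c u d)) N M ν := by
  have hpos := cfVal_pos (v := (1, 2)) one_pos two_pos
    ((List.range' (u + 1) (t + 1 - u)).map (fSeq c u d))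
  rcases hv : cfVal (1, 2) ((List.range' (u + 1) (t + 1 - u)).map (fSeq c u d)) with ⟨κ, K⟩
  rw [hv] at hpos
  have hp := hc.cfVal_eq
  have hs := hrs.cfVal_eq
  rw [cfVal_last_add_two c ht, cfVal_split c hu hut hdc, hv, Prod.swap_prod_mk] at hp
  rw [← map_fSeq_lower c hu] at hs
  have hdiff := cfVal_tsub (Prod.mk_le_mk.2 ⟨hpos.2, κ.zero_le⟩)
    ((List.range' 1 u).map (fSeq c u d))
  rw [hp, hs, Prod.mk_sub_mk, Prod.mk_sub_mk, Nat.sub_zero] at hdiff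
  have hsum := squareGen_eq_sum_lower (PowerSeries.X_ne_zero (R := ℤ)) (by simp; omega)
    (fs := (List.range' 1 u).map (fSeq c u d)) (by simp; omega) hv N M
  rwa [hs, hdiff, ← R_eq_squareGen] at hsum

theorem R_eq_sum_term (hp : 0 < p) (hpp' : p < p') (ht : 1 ≤ t)
    (hc : IsContFrac ((List.range' 1 (t - 1)).map c ++ [c t + 2]) p' p)
    (hu : 1 ≤ u) (hut : u ≤ t) (hd : 1 ≤ d) (hdc : d ≤ c u)
    (hrs : IsContFrac ((List.range' 1 (u - 1)).map c ++ [d]) s r) {N M : ℕ} (hN : M ≤ N) :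
    R N M r (p - r) s (p' - s) = ∑ ν ∈ fermionicIndex (fSeq c u d) t u M M,
      boxGen PowerSeries.X (N - part ν 1 1) (2 * M) * term ⊤ M (fSeq c u d) u d ν := by
  have hf := fSeq_one_ne_zero hp hpp' hc hu hut hd
  have hmem {N : ℕ} (hN : M ≤ N) (ν : List (List ℕ)) := mem_fermionicIndex (ν := ν) hf hu hut hN
  rw [R_eq_sum_lowerWt ht hc hu hut hdc hrs]
  refine Finset.sum_congr (Finset.ext fun ν => (hmem hN ν).trans (hmem le_rfl ν).symm)
    fun ν hν => ?_
  rw [hmem le_rfl, isAdmissible_iff hu] at hν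
  rw [lowerWt_eq hu (by rw [fSeq_self]; omega) (HasBounds.one hf hN u ν) hν, fSeq_self]

end FermionicIndex

end BurgeTree

theorem mainTheorem9 (p p' : ℕ) (hp : 0 < p) (hpp' : p < p') (hcop : Nat.Coprime p p')
    (t : ℕ) (ht : 1 ≤ t) (c : ℕ → ℕ)
    (hc : BurgeTree.IsContFrac ((List.range' 1 (t - 1)).map c ++ [c t + 2]) p' p)
    (u d : ℕ) (hu1 : 1 ≤ u) (hut : u ≤ t) (hd1 : 1 ≤ d) (hdc : d ≤ c u)
    (r s : ℕ)
    (hrs : BurgeTree.IsContFrac ((List.range' 1 (u - 1)).map c ++ [d]) s r)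
    (M : ℕ) :
    {ν | BurgeTree.IsAdmissible ⊤ M t (BurgeTree.fSeq c u d) u ν}.Finite ∧
    Tendsto (fun N : ℕ => BurgeTree.R N M r (p - r) s (p' - s)) atTop
      (𝓝 (BurgeTree.qFactInv (2 * M) *
        ∑ᶠ ν ∈ {ν | BurgeTree.IsAdmissible ⊤ M t (BurgeTree.fSeq c u d) u ν},
          BurgeTree.term ⊤ M (BurgeTree.fSeq c u d) u d ν)) := by
  open BurgeTree in
  have hset : {ν | IsAdmissible ⊤ M t (fSeq c u d) u ν} = fermionicIndex (fSeq c u d) t u M M :=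
    Set.ext fun _ =>
      (mem_fermionicIndex (fSeq_one_ne_zero hp hpp' hc hu1 hut hd1) hu1 hut le_rfl).symm
  rw [hset, finsum_mem_coe_finset, Finset.mul_sum]
  refine ⟨Finset.finite_toSet _, Tendsto.congr' ?_
    (tendsto_finsetSum _ fun ν _ => (tendsto_boxGen (part ν 1 1) _).mul_const _)⟩
  filter_upwards [eventually_ge_atTop M] with N hN
  exact (R_eq_sum_term hp hpp' ht hc hu1 hut hd1 hdc hrs hN).symm
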